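/- Let $G=(V,E)$ be a locally finite unoriented graph (multiple edges allowed) with an at most countable set of vertices $V$, and let $A,Z\subset V$ be finite, disjoint and non-empty. A flow of strength $s$ from $A$ to $Z$ is an antisymmetric function $\theta$ on oriented edges satisfying the node law $\sum_{y\sim x}\theta(\overrightarrow{xy})=0$ at every $x\in V\setminus(A\cup Z)$ and $$s=\sum_{x\in A}\sum_{y\sim x,\,y\notin A}\theta(\overrightarrow{xy})=\sum_{z\in Z}\sum_{y\sim z,\,y\notin Z}\theta(\overrightarrow{yz}).$$ A unit flow is a flow of strength $1$. For resistances $r=(r_e)_{e\in E}$, $r_e>0$, let $$\mathcal R_r(A\leftrightarrow Z)=\inf_{\theta}\sum_{e\in E}r_e\,\theta(e)^2,$$ the infimum being over unit flows $\theta$ from $A$ to $Z$, and let $\theta_r$ denote a unit flow attaining it. Assume that there is a unit flow $\theta$ from $A$ to $Z$ with $\sum_e\theta(e)^2<\infty$ (this is automatic if $G$ is connected). Let $0<a\le b<\infty$, let $(r_e)_{e\in E}$ be i.i.d. with law $\frac12\delta_a+\frac12\delta_b$, and put $f(r)=\mathcal R_r(A\leftrightarrow Z)$. Let $E_m\subset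 E$ have finite complement $E_m^c=E\setminus E_m$, and define $$\alpha_m=\sup_{e\in E_m}\mathbb E\big(r_e\theta_r(e)^2\big),\qquad \beta_m=\frac{|E_m^c|}{\mathbb E(f)},\qquad \varepsilon_m=\Big(\frac{b-a}{a}\Big)^2\alpha_m+(b-a)^2\beta_m$$ (with $\alpha_m=0$ if $E_m=\emptyset$), and $K=\max\big\{\frac{(b-a)^2}{2a},e\big\}$, where $e=\exp(1)$. If $\varepsilon_m<1$, then almost surely $\theta_r$ exists, $r_e\theta_r(e)^2$ is integrable for every edge $e$, $f$ is square integrable with $\mathbb E(f)>0$, and $$\mathrm{Var}(f)\le \frac{2K\,\mathbb E(f)}{\log\dfrac{K}{\varepsilon_m\log (K/\varepsilon_m)}},$$ where the right-hand side is read as $0$ if $\varepsilon_m=0$ (this happens only if $a=b$). -/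

import Mathlib

open MeasureTheory ProbabilityTheory
open scoped ENNReal

noncomputable section

namespace ElectricNetwork

variable {V E : Type*}

/-- Every vertex is incident with finitely many edges (multiple edges and loops are allowed). -/
def LocallyFinite (G : Graph V E) : Prop :=
  ∀ x, {e | G.Inc e x}.Finite

/-- The origin of an edge in a fixed reference orientation, chosen arbitrarily. -/
def tail (G : Graph V E) (e : G.edgeSet) : V :=
  (G.exists_isLink_of_mem_edgeSet e.2).choose

/-- The end of an edge in the same reference orientation. -/
def head (G : Graph V E) (e : G.edgeSet) : V :=
  (G.exists_isLink_of_mem_edgeSet e.2).choose_spec.choose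

theorem isLink_tail_head (G : Graph V E) (e : G.edgeSet) :
    G.IsLink e (tail G e) (head G e) :=
  (G.exists_isLink_of_mem_edgeSet e.2).choose_spec.choose_spec

/-- An antisymmetric function on oriented edges is the same thing as a real function `θ` on edges:
`θ e` is its value on `e` oriented from `tail e` to `head e`, and `-θ e` its value on the reversed
edge. `outflow G θ x S` is the sum of this antisymmetric function over all oriented edges that go
from the vertex `x` to a vertex in `S` (a finite sum in a locally finite graph). -/
def outflow (G : Graph V E) (θ : G.edgeSet → ℝ) (x : V) (S : Set V) : ℝ :=
  (∑ᶠ e ∈ {e | tail G e = x ∧ head G e ∈ S}, θ e)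
    - ∑ᶠ e ∈ {e | head G e = x ∧ tail G e ∈ S}, θ e

/-- `θ` is a flow from the finite set `A` to the finite set `Z` of strength `s`: the node law holds
off `A ∪ Z`, and the flow out of `A` and the flow into `Z` are both equal to `s`. The vertices of
`A` are wired together, as are those of `Z`. -/
structure IsFlow (G : Graph V E) (A Z : Finset V) (s : ℝ) (θ : G.edgeSet → ℝ) : Prop where
  node_law : ∀ x ∈ G.vertexSet, x ∉ A → x ∉ Z → outflow G θ x Set.univ = 0
  flow_out : ∑ x ∈ A, outflow G θ x (A : Set V)ᶜ = s
  flow_in : ∑ z ∈ Z, -outflow G θ z (Z : Set V)ᶜ = s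

/-- The energy `∑ r_e θ(e)²`, possibly infinite, for nonnegative resistances `r`. -/
def energy (G : Graph V E) (r θ : G.edgeSet → ℝ) : ℝ≥0∞ :=
  ∑' e, ENNReal.ofReal (r e * θ e ^ 2)

/-- The infimum of the energy over all flows from `A` to `Z` of strength one, in `[0, ∞]`. -/
def minEnergy (G : Graph V E) (A Z : Finset V) (r : G.edgeSet → ℝ) : ℝ≥0∞ :=
  ⨅ (θ : G.edgeSet → ℝ) (_ : IsFlow G A Z 1 θ), energy G r θ

/-- The effective resistance `R_r(A ↔ Z)` as a real number. -/
def effectiveResistance (G : Graph V E) (A Z : Finset V) (r : G.edgeSet → ℝ) : ℝ :=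
  (minEnergy G A Z r).toReal

/-- `θ` is a flow of strength one from `A` to `Z` that attains the infimum in the definition of
the effective resistance. -/
def IsMinimalFlow (G : Graph V E) (A Z : Finset V) (r θ : G.edgeSet → ℝ) : Prop :=
  IsFlow G A Z 1 θ ∧ energy G r θ = minEnergy G A Z r

open Classical in
/-- The flow `θ_r` attaining the infimum (zero if the infimum is not attained). -/
def minimalFlow (G : Graph V E) (A Z : Finset V) (r : G.edgeSet → ℝ) : G.edgeSet → ℝ :=
  if h : ∃ θ, IsMinimalFlow G A Z r θ then h.choose else 0

/-- The law `½ δ_a + ½ δ_b`. -/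
def bernoulliLaw (a b : ℝ) : Measure ℝ :=
  (2⁻¹ : ℝ≥0∞) • Measure.dirac a + (2⁻¹ : ℝ≥0∞) • Measure.dirac b

end ElectricNetwork

end

/-! The resistances are independent fair bits, so the theorem is a concentration statement on a
product of two-point spaces. Write `Δ_i f` for half the change of `f` when bit `i` is flipped. The
engine is an inequality of Falik–Samorodnitsky type: for every `c > 0`, `Var f * (1 + log c) ≤ c * ∑
(E|Δ_i f|)² + 2 * ∑ E (Δ_i f)²` (`variance_mul_one_add_log_le`). It splits `f` into martingale
differences, bounds the entropy of the square of each from below, and applies the logarithmic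
Sobolev inequality. It gains a logarithm over Poincaré when the `L¹` influences are small. For fixed
`c` it is linear in the variance and passes to the limit of countably many bits
(`integral_sq_sub_mul_one_add_log_le`).

The electrical input is that the minimal flow remains a competitor when one resistance changes.
Hence `|Δ_e f| ≤ (b - a) / 2 * θ(e)²`, with `θ` the minimal flow when `r_e = a`. That value has
probability one half, so `E|Δ_e f|` is at most `(b - a) / a` times the mean energy of `e`. Since
`|θ(e)| ≤ 1`, also `E (Δ_e f)²` is at most `(b - a)² / (2a)` times the mean energy. Mean energies
sum to at most `E f`. So the two sums above are at most `ε * E f` (separating the finitely many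
edges off `Em`) and `K * E f`, and `c = Var f / (ε * E f)` gives the bound unless the variance is
already small.

The minimal flow is a Hilbert space projection (`exists_isPythagoreanFlow`). Truncating potentials
gives `|θ(e)| ≤ 1` (`abs_le_one_of_mem_closure`), and a stability estimate gives continuity in the
product topology (`tendsto_minimalFlow`), hence measurability and the passage from finitely many
edges to all of them. -/

namespace BooleanCube

/-! ### Functional inequalities on the discrete cube. -/

/-- The mean of a function on the discrete cube for the uniform law. -/
noncomputable def avg {n : ℕ} (g : (Fin n → Bool) → ℝ) : ℝ := (∑ x, g x) / 2 ^ n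

/-- Half the change of `g` when the coordinate `i` is flipped. -/
noncomputable def influence {n : ℕ} (i : Fin n) (g : (Fin n → Bool) → ℝ) (x : Fin n → Bool) : ℝ :=
  (g x - g (Function.update x i (!x i))) / 2

theorem avg_zero (g : (Fin 0 → Bool) → ℝ) (x : Fin 0 → Bool) : avg g = g x := by
  rw [avg, Fintype.sum_subsingleton _ x, pow_zero, div_one]

theorem avg_succ {n : ℕ} (g : (Fin (n + 1) → Bool) → ℝ) :
    avg g = (avg (fun y => g (Fin.cons true y)) + avg (fun y => g (Fin.cons false y))) / 2 := by
  have h : ∑ x, g x = ∑ p : Bool × (Fin n → Bool), g (Fin.cons p.1 p.2) :=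
    (Fintype.sum_equiv (Fin.consEquiv (fun _ => Bool)) _ _ (fun p => rfl)).symm
  simp only [avg, h, Fintype.sum_prod_type, Fintype.sum_bool]
  field_simp
  ring

theorem avg_add {n : ℕ} (g h : (Fin n → Bool) → ℝ) :
    avg (fun x => g x + h x) = avg g + avg h := by
  simp [avg, Finset.sum_add_distrib, add_div]

theorem avg_const_mul {n : ℕ} (c : ℝ) (g : (Fin n → Bool) → ℝ) :
    avg (fun x => c * g x) = c * avg g := by
  rw [avg, avg, ← Finset.mul_sum, mul_div_assoc]

theorem avg_mono {n : ℕ} {g h : (Fin n → Bool) → ℝ} (H : ∀ x, g x ≤ h x) : avg g ≤ avg h := by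
  unfold avg
  gcongr
  exact H _

theorem avg_nonneg {n : ℕ} {g : (Fin n → Bool) → ℝ} (H : ∀ x, 0 ≤ g x) : 0 ≤ avg g :=
  div_nonneg (Finset.sum_nonneg fun x _ => H x) (by positivity)

theorem eq_zero_of_avg_eq_zero {n : ℕ} {g : (Fin n → Bool) → ℝ} (H : ∀ x, 0 ≤ g x)
    (h0 : avg g = 0) (x : Fin n → Bool) : g x = 0 := by
  have h1 : ∑ x, g x = 0 := by
    rcases div_eq_zero_iff.1 h0 with h | h
    · exact h
    · exact absurd h (by positivity)
  exact (Finset.sum_eq_zero_iff_of_nonneg fun x _ => H x).1 h1 x (Finset.mem_univ x)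

theorem avg_mul_le_sqrt {n : ℕ} (g h : (Fin n → Bool) → ℝ) :
    avg (fun x => g x * h x) ≤ √(avg fun x => g x ^ 2) * √(avg fun x => h x ^ 2) := by
  have h2 : (0 : ℝ) < 2 ^ n := by positivity
  unfold avg
  rw [Real.sqrt_div (Finset.sum_nonneg fun x _ => sq_nonneg _),
    Real.sqrt_div (Finset.sum_nonneg fun x _ => sq_nonneg _), div_mul_div_comm,
    Real.mul_self_sqrt h2.le]
  gcongr
  exact Real.sum_mul_le_sqrt_mul_sqrt _ _ _

theorem influence_zero_cons {n : ℕ} (g : (Fin (n + 1) → Bool) → ℝ) (c : Bool)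
    (y : Fin n → Bool) :
    influence 0 g (Fin.cons c y) = (g (Fin.cons c y) - g (Fin.cons (!c) y)) / 2 := by
  simp [influence, Fin.update_cons_zero]

theorem influence_succ_cons {n : ℕ} (i : Fin n) (g : (Fin (n + 1) → Bool) → ℝ) (c : Bool)
    (y : Fin n → Bool) :
    influence i.succ g (Fin.cons c y) = influence i (fun y => g (Fin.cons c y)) y := by
  simp [influence, ← Fin.cons_update]

/-- The logarithmic Sobolev inequality on the two-point space. -/
theorem two_point_log_sobolev {s t : ℝ} (hs : 0 ≤ s) (ht : 0 ≤ t) :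
    (s ^ 2 * Real.log (s ^ 2) + t ^ 2 * Real.log (t ^ 2)) / 2
      - (s ^ 2 + t ^ 2) / 2 * Real.log ((s ^ 2 + t ^ 2) / 2) ≤ (s - t) ^ 2 / 2 := by
  wlog hst : t ≤ s generalizing s t
  · have := this ht hs (le_of_not_ge hst)
    rw [add_comm (t ^ 2), add_comm (t ^ 2 * _)] at this
    nlinarith
  rcases hs.eq_or_lt with rfl | hs0
  · have : t = 0 := le_antisymm hst ht
    simp [this]
  -- With `t` fixed, the deficit `h` vanishes at `u = t`; it suffices that it increases on `[t, ∞)`.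
  set h : ℝ → ℝ := fun u => (u - t) ^ 2 / 2
    - ((u ^ 2 * Real.log (u ^ 2) + t ^ 2 * Real.log (t ^ 2)) / 2
      - (u ^ 2 + t ^ 2) / 2 * Real.log ((u ^ 2 + t ^ 2) / 2)) with hh
  have hcont : Continuous h := by
    have h1 := Real.continuous_mul_log
    have h2 : Continuous fun u : ℝ => u ^ 2 * Real.log (u ^ 2) :=
      h1.comp (continuous_pow 2)
    have h3 : Continuous fun u : ℝ => (u ^ 2 + t ^ 2) / 2 * Real.log ((u ^ 2 + t ^ 2) / 2) :=
      h1.comp (by fun_prop : Continuous fun u : ℝ => (u ^ 2 + t ^ 2) / 2)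
    simp only [hh]
    fun_prop
  have hder : ∀ u, 0 < u → HasDerivAt h
      ((u - t) - u * (Real.log (u ^ 2) - Real.log ((u ^ 2 + t ^ 2) / 2))) u := by
    intro u hu
    have hm : (u ^ 2 + t ^ 2) / 2 ≠ 0 := by positivity
    have hu2 : u ^ 2 ≠ 0 := by positivity
    have e1 : HasDerivAt (fun u : ℝ => u ^ 2) (2 * u) u := by
      simpa using hasDerivAt_pow 2 u
    have e2 := HasDerivAt.comp (h₂ := fun v : ℝ => v * Real.log v) (h := fun u : ℝ => u ^ 2) u
      (Real.hasDerivAt_mul_log hu2) e1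
    have e3 : HasDerivAt (fun u : ℝ => (u ^ 2 + t ^ 2) / 2) u u := by
      have := (e1.add_const (t ^ 2)).div_const 2
      simpa using this
    have e4 := HasDerivAt.comp (h₂ := fun v : ℝ => v * Real.log v)
      (h := fun u : ℝ => (u ^ 2 + t ^ 2) / 2) u (Real.hasDerivAt_mul_log hm) e3
    have e5 : HasDerivAt (fun u : ℝ => (u - t) ^ 2 / 2) (u - t) u := by
      have := (((hasDerivAt_id u).sub_const t).pow 2).div_const 2
      simpa using this
    have := e5.sub (((e2.add_const (t ^ 2 * Real.log (t ^ 2))).div_const 2).sub e4)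
    refine this.congr_deriv ?_
    ring
  have hmono : MonotoneOn h (Set.Ici t) := by
    refine monotoneOn_of_deriv_nonneg (convex_Ici t) hcont.continuousOn ?_ ?_
    · intro u hu
      rw [interior_Ici] at hu
      exact (hder u (ht.trans_lt hu)).differentiableAt.differentiableWithinAt
    · intro u hu
      rw [interior_Ici] at hu
      have hu0 : 0 < u := ht.trans_lt hu
      rw [(hder u hu0).deriv]
      have hm : 0 < (u ^ 2 + t ^ 2) / 2 := by positivity
      rw [← Real.log_div (by positivity) hm.ne']
      have hx : 0 ≤ 1 - t / u := by
        rw [sub_nonneg, div_le_one hu0]; exact (Set.mem_Ioi.1 hu).le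
      -- The sign of the derivative is that of `1 - t/u - log` of this quotient. With `q = t/u`, the
      -- quadratic lower bound for `exp` suffices, with the spare factor `1 + (1 - q)⁴ / 4`.
      have key : u ^ 2 / ((u ^ 2 + t ^ 2) / 2) ≤ Real.exp (1 - t / u) := by
        refine le_trans ?_ (Real.quadratic_le_exp_of_nonneg hx)
        rw [div_le_iff₀ hm]
        have e : t = (t / u) * u := by field_simp
        set q := t / u
        rw [e]
        have : (1 + (1 - q) + (1 - q) ^ 2 / 2) * ((u ^ 2 + (q * u) ^ 2) / 2)
          = u ^ 2 * (1 + (1 - q) ^ 4 / 4) := by ring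
        rw [this]
        nlinarith [mul_nonneg (sq_nonneg u) (sq_nonneg ((1 - q) ^ 2))]
      have h2 := Real.log_le_log (by positivity) key
      rw [Real.log_exp] at h2
      have h3 := mul_le_mul_of_nonneg_left h2 hu0.le
      have h4 : u * (1 - t / u) = u - t := by field_simp
      linarith
  have := hmono (Set.mem_Ici.2 le_rfl) (Set.mem_Ici.2 hst) hst
  have h0 : h t = 0 := by simp only [hh]; ring_nf
  rw [h0] at this
  simp only [hh] at this
  linarith

/-- The logarithmic Sobolev inequality on the discrete cube. -/
theorem log_sobolev {n : ℕ} (g : (Fin n → Bool) → ℝ) :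
    avg (fun x => g x ^ 2 * Real.log (g x ^ 2))
        - avg (fun x => g x ^ 2) * Real.log (avg fun x => g x ^ 2)
      ≤ 2 * ∑ i, avg (fun x => influence i g x ^ 2) := by
  induction n with
  | zero => simp [avg_zero _ default]
  | succ n ih =>
    set g₁ : (Fin n → Bool) → ℝ := fun y => g (Fin.cons true y) with hg₁
    set g₀ : (Fin n → Bool) → ℝ := fun y => g (Fin.cons false y) with hg₀
    have i₁ := ih g₁
    have i₀ := ih g₀
    have hp₁ : 0 ≤ avg fun x => g₁ x ^ 2 := avg_nonneg fun _ => sq_nonneg _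
    have hp₀ : 0 ≤ avg fun x => g₀ x ^ 2 := avg_nonneg fun _ => sq_nonneg _
    -- The entropy splits into the mean entropy of the two halves and a two-point entropy of their
    -- `L²` norms. Cauchy–Schwarz bounds the squared difference of the norms by `avg (g₁ - g₀)²`,
    -- the contribution of coordinate `0`.
    have tp := two_point_log_sobolev (Real.sqrt_nonneg (avg fun x => g₁ x ^ 2))
      (Real.sqrt_nonneg (avg fun x => g₀ x ^ 2))
    have cs := avg_mul_le_sqrt g₁ g₀
    have hd : avg (fun y => (g₁ y - g₀ y) ^ 2)
        = avg (fun y => g₁ y ^ 2) + avg (fun y => g₀ y ^ 2)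
          + (-2) * avg (fun y => g₁ y * g₀ y) := by
      rw [← avg_const_mul, ← avg_add, ← avg_add]
      congr 1; ext y; ring
    have h0 : avg (fun x => influence 0 g x ^ 2) = avg (fun y => (g₁ y - g₀ y) ^ 2) / 4 := by
      rw [avg_succ]
      simp only [influence_zero_cons, Bool.not_true, Bool.not_false]
      have e1 : (fun y => ((g (Fin.cons true y) - g (Fin.cons false y)) / 2) ^ 2)
        = fun y => (1 / 4) * (g₁ y - g₀ y) ^ 2 := by ext y; ring
      have e2 : (fun y => ((g (Fin.cons false y) - g (Fin.cons true y)) / 2) ^ 2)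
        = fun y => (1 / 4) * (g₁ y - g₀ y) ^ 2 := by ext y; ring
      rw [e1, e2, avg_const_mul]; ring
    have hi : ∀ i : Fin n, avg (fun x => influence i.succ g x ^ 2)
        = (avg (fun y => influence i g₁ y ^ 2) + avg (fun y => influence i g₀ y ^ 2)) / 2 := by
      intro i
      rw [avg_succ]
      simp only [influence_succ_cons]
      rfl
    rw [Fin.sum_univ_succ, h0, hd, avg_succ, avg_succ (fun x => g x ^ 2)]
    simp only [hi, ← Finset.sum_div, Finset.sum_add_distrib]
    rw [Real.sq_sqrt hp₁, Real.sq_sqrt hp₀, sub_sq, Real.sq_sqrt hp₁, Real.sq_sqrt hp₀] at tp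
    linarith

/-- The convex function `t log t` lies above its tangent at `c`. -/
theorem mul_one_add_log_sub_le {t c : ℝ} (ht : 0 ≤ t) (hc : 0 < c) :
    t * (1 + Real.log c) - c ≤ t * Real.log t := by
  rcases ht.eq_or_lt with rfl | ht
  · simp [hc.le]
  have h := Real.log_le_sub_one_of_pos (div_pos hc ht)
  rw [Real.log_div hc.ne' ht.ne'] at h
  have h2 := mul_le_mul_of_nonneg_left h ht.le
  have h3 : t * (c / t - 1) = c - t := by field_simp
  linarith

/-- The entropy of `h²` dominates an affine function of the squared `L²` norm. -/
theorem le_entropy_sq {n : ℕ} (h : (Fin n → Bool) → ℝ) {c : ℝ} (hc : 0 < c) :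
    avg (fun x => h x ^ 2) * (1 + Real.log c) - c * avg (fun x => |h x|) ^ 2
      ≤ avg (fun x => h x ^ 2 * Real.log (h x ^ 2))
        - avg (fun x => h x ^ 2) * Real.log (avg fun x => h x ^ 2) := by
  set p := avg fun x => h x ^ 2 with hp
  set q := avg fun x => |h x| with hq
  have hp0 : 0 ≤ p := avg_nonneg fun _ => sq_nonneg _
  have hq0 : 0 ≤ q := avg_nonneg fun _ => abs_nonneg _
  rcases hp0.eq_or_lt with hp00 | hp1
  · have hz : ∀ x, h x = 0 := fun x => by
      have := eq_zero_of_avg_eq_zero (fun x => sq_nonneg (h x)) hp00.symm x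
      exact pow_eq_zero_iff (two_ne_zero) |>.1 this
    rw [← hp00]
    simp [hz, avg]
    positivity
  have hq1 : 0 < q := by
    refine lt_of_le_of_ne hq0 fun h0 => hp1.ne' ?_
    have hz : ∀ x, h x = 0 := fun x =>
      abs_eq_zero.1 (eq_zero_of_avg_eq_zero (fun x => abs_nonneg (h x)) h0.symm x)
    simp [hp, hz, avg]
  have hpq := div_pos hp1 hq1
  -- Tangent at `p / q`, multiplied by `2|h|`: after averaging, the linear terms collapse to `2p log
  -- (p / q)`, so the entropy is at least `p log (p / q²)`.
  have pt : ∀ x, 2 * (1 + Real.log (p / q)) * h x ^ 2 + (-(2 * (p / q))) * |h x|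
      ≤ h x ^ 2 * Real.log (h x ^ 2) := by
    intro x
    have h1 := mul_le_mul_of_nonneg_left (mul_one_add_log_sub_le (abs_nonneg (h x)) hpq)
      (mul_nonneg zero_le_two (abs_nonneg (h x)))
    rw [← sq_abs (h x), Real.log_pow]
    push_cast
    nlinarith
  have h1 := avg_mono pt
  rw [avg_add, avg_const_mul, avg_const_mul, ← hp, ← hq, Real.log_div hp1.ne' hq1.ne'] at h1
  have e1 : p / q * q = p := by field_simp
  -- The bound `log x ≤ x - 1` at `x = c q² / p` replaces `p log (p / q²)` by an expression affine
  -- in `p`.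
  have h2 := Real.log_le_sub_one_of_pos (div_pos (mul_pos hc (pow_pos hq1 2)) hp1)
  rw [Real.log_div (by positivity) hp1.ne', Real.log_mul hc.ne' (by positivity),
    Real.log_pow] at h2
  have h3 := mul_le_mul_of_nonneg_left h2 hp0
  have e2 : p * (c * q ^ 2 / p - 1) = c * q ^ 2 - p := by field_simp
  push_cast at h3
  nlinarith

/-- The Falik–Samorodnitsky inequality on the discrete cube, in a form that is linear in the
variance. -/
theorem variance_mul_one_add_log_le {n : ℕ} (g : (Fin n → Bool) → ℝ) {c : ℝ} (hc : 0 < c) :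
    (avg (fun x => g x ^ 2) - avg g ^ 2) * (1 + Real.log c)
      ≤ c * ∑ i, avg (fun x => |influence i g x|) ^ 2
        + 2 * ∑ i, avg (fun x => influence i g x ^ 2) := by
  induction n with
  | zero => simp [avg_zero _ default]
  | succ n ih =>
    set g₁ : (Fin n → Bool) → ℝ := fun y => g (Fin.cons true y) with hg₁
    set g₀ : (Fin n → Bool) → ℝ := fun y => g (Fin.cons false y) with hg₀
    -- The first martingale difference is `±h`, and `m` is the mean over coordinate `0`. Induction
    -- handles `m`, entropy and log-Sobolev handle `h`. The `L²` influences of `g` in the other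
    -- coordinates split exactly between `m` and `h`, while averaging can only decrease the `L¹`
    -- ones.
    set m : (Fin n → Bool) → ℝ := fun y => (g₁ y + g₀ y) / 2 with hm
    set h : (Fin n → Bool) → ℝ := fun y => (g₁ y - g₀ y) / 2 with hh
    have im := ih m
    have ih' := (le_entropy_sq h hc).trans (log_sobolev h)
    have hvar : avg (fun x => g x ^ 2) = avg (fun y => m y ^ 2) + avg (fun y => h y ^ 2) := by
      rw [avg_succ, ← avg_add, ← avg_add]
      rw [div_eq_inv_mul, ← avg_const_mul]
      congr 1; ext y; simp only [hm, hh, hg₁, hg₀]; ring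
    have hmean : avg g = avg m := by
      rw [avg_succ, ← avg_add, div_eq_inv_mul, ← avg_const_mul]
      congr 1; ext y; simp only [hm, hg₁, hg₀]; ring
    have h01 : avg (fun x => |influence 0 g x|) = avg (fun y => |h y|) := by
      rw [avg_succ]
      simp only [influence_zero_cons, Bool.not_true, Bool.not_false]
      have e1 : (fun y => |(g (Fin.cons false y) - g (Fin.cons true y)) / 2|)
        = fun y => |h y| := by
        ext y; rw [← abs_neg]; congr 1; simp only [hh, hg₁, hg₀]; ring
      rw [e1]
      simp only [hh, hg₁, hg₀]; ring
    have h02 : 0 ≤ avg (fun x => influence 0 g x ^ 2) := avg_nonneg fun _ => sq_nonneg _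
    have hi1 : ∀ i : Fin n, avg (fun y => |influence i m y|)
        ≤ avg (fun x => |influence i.succ g x|) := by
      intro i
      rw [avg_succ, ← avg_add, div_eq_inv_mul, ← avg_const_mul]
      refine avg_mono fun y => ?_
      simp only [influence_succ_cons]
      have : influence i m y = 2⁻¹ * (influence i g₁ y + influence i g₀ y) := by
        simp only [influence, hm]; ring
      rw [this, abs_mul, abs_of_pos (by norm_num : (0:ℝ) < 2⁻¹)]
      gcongr
      exact abs_add_le _ _
    have hi2 : ∀ i : Fin n, avg (fun x => influence i.succ g x ^ 2)
        = avg (fun y => influence i m y ^ 2) + avg (fun y => influence i h y ^ 2) := by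
      intro i
      rw [avg_succ, ← avg_add, ← avg_add, div_eq_inv_mul, ← avg_const_mul]
      congr 1; ext y
      simp only [influence_succ_cons]
      simp only [influence, hm, hh, hg₁, hg₀]; ring
    have hs : ∑ i, avg (fun y => |influence i m y|) ^ 2
        ≤ ∑ i : Fin n, avg (fun x => |influence i.succ g x|) ^ 2 :=
      Finset.sum_le_sum fun i _ =>
        pow_le_pow_left₀ (avg_nonneg fun _ => abs_nonneg _) (hi1 i) 2
    have hs' := mul_le_mul_of_nonneg_left hs hc.le
    rw [Fin.sum_univ_succ, Fin.sum_univ_succ, hvar, hmean, h01]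
    simp only [hi2, Finset.sum_add_distrib]
    linarith

end BooleanCube

/-! ### Flows as linear functionals on gradients. -/

namespace ElectricNetwork

variable {V E : Type*}

/-- The difference of a function on vertices along an edge in its reference orientation. -/
noncomputable def gradient (G : Graph V E) (u : V → ℝ) (e : G.edgeSet) : ℝ :=
  u (tail G e) - u (head G e)

/-- Finitely supported functions on vertices that are constant on `A` and on `Z`. -/
structure IsTestFunction (A Z : Finset V) (u : V → ℝ) : Prop where
  finite_support : (Function.support u).Finite
  const_left : ∀ x ∈ A, ∀ y ∈ A, u x = u y
  const_right : ∀ x ∈ Z, ∀ y ∈ Z, u x = u y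

theorem finite_setOf_tail_or_head_mem {G : Graph V E} (hG : LocallyFinite G) {T : Set V}
    (hT : T.Finite) : {e : G.edgeSet | tail G e ∈ T ∨ head G e ∈ T}.Finite := by
  have h : (⋃ x ∈ T, {e | G.Inc e x}).Finite := hT.biUnion fun x _ => hG x
  refine (h.preimage Subtype.val_injective.injOn).subset ?_
  intro e he
  simp only [Set.mem_preimage, Set.mem_iUnion, Set.mem_ofPred_eq, exists_prop]
  rcases he with he | he
  · exact ⟨_, he, _, isLink_tail_head G e⟩
  · exact ⟨_, he, _, (isLink_tail_head G e).symm⟩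

theorem countable_edgeSet {G : Graph V E} (hV : G.vertexSet.Countable) (hG : LocallyFinite G) :
    Countable G.edgeSet := by
  have h : (⋃ x ∈ G.vertexSet, {e | G.Inc e x}).Countable :=
    hV.biUnion fun x _ => (hG x).countable
  refine Set.Countable.mono ?_ h
  intro e he
  simp only [Set.mem_iUnion, Set.mem_ofPred_eq, exists_prop]
  exact ⟨_, (isLink_tail_head G ⟨e, he⟩).left_mem, _, isLink_tail_head G ⟨e, he⟩⟩

theorem finite_support_gradient {G : Graph V E} (hG : LocallyFinite G) {u : V → ℝ}
    (hu : (Function.support u).Finite) : (Function.support (gradient G u)).Finite := by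
  refine (finite_setOf_tail_or_head_mem hG hu).subset fun e he => ?_
  by_contra h
  simp only [Set.mem_ofPred_eq, Function.mem_support, not_or, not_not] at h
  exact he (by rw [gradient, h.1, h.2, sub_zero])

theorem finsum_gradient_mul_eq_sum {G : Graph V E} {T : Finset V} {B : Finset G.edgeSet}
    (hB : ∀ e, tail G e ∈ T ∨ head G e ∈ T → e ∈ B) {u : V → ℝ}
    (hu : Function.support u ⊆ T) (θ : G.edgeSet → ℝ) :
    ∑ᶠ e, gradient G u e * θ e = ∑ e ∈ B, gradient G u e * θ e := by
  refine finsum_eq_sum_of_support_subset _ fun e he => ?_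
  refine hB e ?_
  by_contra h
  push Not at h
  have h1 : u (tail G e) = 0 := by
    by_contra h'; exact h.1 (hu h')
  have h2 : u (head G e) = 0 := by
    by_contra h'; exact h.2 (hu h')
  exact he (by simp [gradient, h1, h2])

open Classical in
theorem outflow_eq_sum {G : Graph V E} {x : V} {B : Finset G.edgeSet}
    (hB : ∀ e, tail G e = x ∨ head G e = x → e ∈ B) (θ : G.edgeSet → ℝ) (S : Set V) :
    outflow G θ x S = ∑ e ∈ B, ((if tail G e = x ∧ head G e ∈ S then 1 else 0)
      - (if head G e = x ∧ tail G e ∈ S then 1 else 0)) * θ e := by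
  have h1 : ∑ᶠ e ∈ {e | tail G e = x ∧ head G e ∈ S}, θ e
      = ∑ e ∈ B, (if tail G e = x ∧ head G e ∈ S then 1 else 0) * θ e := by
    rw [finsum_mem_def, finsum_eq_sum_of_support_subset (s := B)]
    · refine Finset.sum_congr rfl fun e _ => ?_
      simp [Set.indicator_apply]
    · intro e he
      exact hB e (Or.inl (Set.mem_of_indicator_ne_zero he).1)
  have h2 : ∑ᶠ e ∈ {e | head G e = x ∧ tail G e ∈ S}, θ e
      = ∑ e ∈ B, (if head G e = x ∧ tail G e ∈ S then 1 else 0) * θ e := by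
    rw [finsum_mem_def, finsum_eq_sum_of_support_subset (s := B)]
    · refine Finset.sum_congr rfl fun e _ => ?_
      simp [Set.indicator_apply]
    · intro e he
      exact hB e (Or.inr (Set.mem_of_indicator_ne_zero he).1)
  rw [outflow, h1, h2, ← Finset.sum_sub_distrib]
  exact Finset.sum_congr rfl fun e _ => by ring

open Classical in
theorem outflow_univ_eq {G : Graph V E} (hG : LocallyFinite G) (θ : G.edgeSet → ℝ) (x : V) :
    outflow G θ x Set.univ = ∑ᶠ e, gradient G (fun y => if y = x then 1 else 0) e * θ e := by
  have hfin := finite_setOf_tail_or_head_mem hG (Set.finite_singleton x)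
  have hB : ∀ e, tail G e = x ∨ head G e = x → e ∈ hfin.toFinset := fun e he => by simpa using he
  rw [outflow_eq_sum hB, finsum_gradient_mul_eq_sum (T := {x}) (B := hfin.toFinset)]
  · simp [gradient]
  · simp
  · intro y hy
    by_contra h
    exact hy (if_neg (by simpa using h))

-- Edges with both ends in `A` count on neither side: the indicator of `A` has zero gradient along
-- them.
open Classical in
theorem sum_outflow_compl_eq {G : Graph V E} (hG : LocallyFinite G) (θ : G.edgeSet → ℝ)
    (A : Finset V) :
    ∑ x ∈ A, outflow G θ x (A : Set V)ᶜ
      = ∑ᶠ e, gradient G (fun y => if y ∈ A then 1 else 0) e * θ e := by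
  have hfin := finite_setOf_tail_or_head_mem hG A.finite_toSet
  have hB : ∀ e, tail G e ∈ A ∨ head G e ∈ A → e ∈ hfin.toFinset := fun e he => by simpa using he
  rw [finsum_gradient_mul_eq_sum (T := A) (B := hfin.toFinset) hB]
  · have hBx : ∀ x ∈ A, ∀ e, tail G e = x ∨ head G e = x → e ∈ hfin.toFinset := by
      rintro x hx e (rfl | rfl)
      exacts [hB e (Or.inl hx), hB e (Or.inr hx)]
    rw [Finset.sum_congr rfl fun x hx => outflow_eq_sum (hBx x hx) θ _, Finset.sum_comm]
    refine Finset.sum_congr rfl fun e _ => ?_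
    rw [← Finset.sum_mul]
    congr 1
    rw [Finset.sum_sub_distrib, gradient]
    by_cases h1 : tail G e ∈ A <;> by_cases h2 : head G e ∈ A <;> simp [h1, h2]
  · intro y hy
    by_contra h
    exact hy (if_neg (by simpa using h))

/-- A flow is determined by its pairing with the gradients of test functions. -/
theorem isFlow_iff {G : Graph V E} (hG : LocallyFinite G) {A Z : Finset V} (hAZ : Disjoint A Z)
    {x₀ z₀ : V} (hx₀ : x₀ ∈ A) (hz₀ : z₀ ∈ Z) (s : ℝ) (θ : G.edgeSet → ℝ) :
    IsFlow G A Z s θ ↔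
      ∀ u, IsTestFunction A Z u → ∑ᶠ e, gradient G u e * θ e = s * (u x₀ - u z₀) := by
  classical
  have hd : ∀ {x}, x ∈ A → x ∉ Z := fun h => Finset.disjoint_left.1 hAZ h
  have hd' : ∀ {x}, x ∈ Z → x ∉ A := fun h => Finset.disjoint_right.1 hAZ h
  constructor
  · intro hθ u hu
    set T : Finset V := hu.finite_support.toFinset ∪ A ∪ Z with hT
    have hfin := finite_setOf_tail_or_head_mem hG T.finite_toSet
    have hB : ∀ e, tail G e ∈ T ∨ head G e ∈ T → e ∈ hfin.toFinset :=
      fun e he => by simpa using he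
    have hAT : A ⊆ T := fun x hx => by simp [hT, hx]
    have hZT : Z ⊆ T := fun x hx => by simp [hT, hx]
    -- A test function is a combination of indicators of single vertices off the terminals and of
    -- the indicators of `A` and of `Z`; each of these pairs with `θ` through exactly one of the
    -- flow conditions.
    have hu_eq : ∀ y, u y = ∑ x ∈ T \ (A ∪ Z), u x * (if y = x then 1 else 0)
        + u x₀ * (if y ∈ A then 1 else 0) + u z₀ * (if y ∈ Z then 1 else 0) := by
      intro y
      by_cases hyA : y ∈ A
      · have h1 : ∑ x ∈ T \ (A ∪ Z), u x * (if y = x then 1 else 0) = 0 := by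
          simp [hyA]
        rw [h1, if_pos hyA, if_neg (hd hyA), hu.const_left y hyA x₀ hx₀]; ring
      by_cases hyZ : y ∈ Z
      · have h1 : ∑ x ∈ T \ (A ∪ Z), u x * (if y = x then 1 else 0) = 0 := by
          simp [hyZ]
        rw [h1, if_pos hyZ, if_neg hyA, hu.const_right y hyZ z₀ hz₀]; ring
      · rw [if_neg hyA, if_neg hyZ]
        simp only [mul_ite, mul_one, mul_zero, Finset.sum_ite_eq, add_zero]
        split_ifs with h
        · rfl
        · by_contra h0
          exact h (by simp [hT, hyA, hyZ, h0])
    have hgrad : ∀ e, gradient G u e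
        = ∑ x ∈ T \ (A ∪ Z), u x * gradient G (fun y => if y = x then 1 else 0) e
          + u x₀ * gradient G (fun y => if y ∈ A then 1 else 0) e
          + u z₀ * gradient G (fun y => if y ∈ Z then 1 else 0) e := by
      intro e
      rw [gradient, hu_eq (tail G e), hu_eq (head G e)]
      simp only [gradient, mul_sub, Finset.sum_sub_distrib]
      ring
    have hA := hθ.flow_out
    have hZ := hθ.flow_in
    rw [Finset.sum_neg_distrib, sum_outflow_compl_eq hG,
      finsum_gradient_mul_eq_sum (T := T) (B := hfin.toFinset) hB] at hZ
    rw [sum_outflow_compl_eq hG,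
      finsum_gradient_mul_eq_sum (T := T) (B := hfin.toFinset) hB] at hA
    rw [finsum_gradient_mul_eq_sum (T := T) (B := hfin.toFinset) hB]
    · simp only [hgrad, add_mul, Finset.sum_add_distrib, Finset.sum_mul]
      rw [Finset.sum_comm]
      have h0 : ∑ x ∈ T \ (A ∪ Z), ∑ e ∈ hfin.toFinset,
          u x * gradient G (fun y => if y = x then 1 else 0) e * θ e = 0 := by
        refine Finset.sum_eq_zero fun x hx => ?_
        simp only [mul_assoc]
        rw [← Finset.mul_sum]
        simp only [Finset.mem_sdiff, Finset.mem_union, not_or] at hx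
        have h1 : ∑ᶠ e, gradient G (fun y => if y = x then 1 else 0) e * θ e = 0 := by
          by_cases hxG : x ∈ G.vertexSet
          · rw [← outflow_univ_eq hG]
            exact hθ.node_law x hxG hx.2.1 hx.2.2
          · have : ∀ e, gradient G (fun y => if y = x then (1 : ℝ) else 0) e = 0 := by
              intro e
              have hl := isLink_tail_head G e
              have e1 : tail G e ≠ x := fun h => hxG (h ▸ hl.left_mem)
              have e2 : head G e ≠ x := fun h => hxG (h ▸ hl.right_mem)
              simp [gradient, e1, e2]
            simp [this]
        rw [finsum_gradient_mul_eq_sum (T := T) (B := hfin.toFinset) hB] at h1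
        · rw [h1, mul_zero]
        · intro y hy
          have : y = x := by
            by_contra h
            exact hy (if_neg h)
          rw [this]
          exact hx.1
      simp only [mul_assoc, ← Finset.mul_sum] at h0 ⊢
      rw [h0, hA]
      linear_combination (-u z₀) * hZ
    · intro y hy
      simp only [hT, Finset.coe_union, Set.Finite.coe_toFinset]
      exact Or.inl (Or.inl hy)
    · intro y hy
      have : y ∈ A := by
        by_contra h
        exact hy (if_neg h)
      exact hAT this
    · intro y hy
      have : y ∈ Z := by
        by_contra h
        exact hy (if_neg h)
      exact hZT this
  · intro H
    refine ⟨fun x _ hxA hxZ => ?_, ?_, ?_⟩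
    · rw [outflow_univ_eq hG, H]
      · have h1 : x₀ ≠ x := fun h => hxA (h ▸ hx₀)
        have h2 : z₀ ≠ x := fun h => hxZ (h ▸ hz₀)
        simp [h1, h2]
      · refine ⟨(Set.finite_singleton x).subset fun y hy => ?_, fun y hy y' hy' => ?_,
          fun y hy y' hy' => ?_⟩
        · by_contra h
          exact hy (if_neg (by simpa using h))
        · rw [if_neg (ne_of_mem_of_not_mem hy hxA), if_neg (ne_of_mem_of_not_mem hy' hxA)]
        · rw [if_neg (ne_of_mem_of_not_mem hy hxZ), if_neg (ne_of_mem_of_not_mem hy' hxZ)]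
    · rw [sum_outflow_compl_eq hG, H]
      · simp [hx₀, hd' hz₀]
      · refine ⟨A.finite_toSet.subset fun y hy => ?_, fun y hy y' hy' => ?_,
          fun y hy y' hy' => ?_⟩
        · by_contra h
          exact hy (if_neg (by simpa using h))
        · rw [if_pos hy, if_pos hy']
        · rw [if_neg (hd' hy), if_neg (hd' hy')]
    · rw [Finset.sum_neg_distrib, sum_outflow_compl_eq hG, H]
      · simp [hz₀, hd hx₀]
      · refine ⟨Z.finite_toSet.subset fun y hy => ?_, fun y hy y' hy' => ?_,
          fun y hy y' hy' => ?_⟩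
        · by_contra h
          exact hy (if_neg (by simpa using h))
        · rw [if_neg (hd hy), if_neg (hd hy')]
        · rw [if_pos hy, if_pos hy']

end ElectricNetwork

/-! ### The minimal flow as an orthogonal projection in `ℓ²`. -/

namespace ElectricNetwork

variable {V E : Type*}

theorem memℓp_two_iff {ι : Type*} {φ : ι → ℝ} :
    Memℓp φ 2 ↔ Summable fun i => φ i ^ 2 := by
  rw [memℓp_gen_iff (by norm_num)]
  simp

theorem lp_two_inner {ι : Type*} (φ ψ : lp (fun _ : ι => ℝ) 2) :
    inner ℝ φ ψ = ∑' i, φ i * ψ i := by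
  rw [lp.inner_eq_tsum]
  exact tsum_congr fun i => by simp [mul_comm]

theorem lp_two_norm_sq {ι : Type*} (φ : lp (fun _ : ι => ℝ) 2) :
    ‖φ‖ ^ 2 = ∑' i, φ i ^ 2 := by
  rw [← real_inner_self_eq_norm_sq, lp_two_inner]
  exact tsum_congr fun i => by ring

theorem memℓp_two_of_finite_support {ι : Type*} {φ : ι → ℝ} (h : (Function.support φ).Finite) :
    Memℓp φ 2 := by
  refine memℓp_two_iff.2 (summable_of_hasFiniteSupport (h.subset fun i hi => ?_))
  contrapose! hi
  simp_all

theorem finite_support_gradient_div {G : Graph V E} (hG : LocallyFinite G) {A Z : Finset V}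
    {u : V → ℝ} (hu : IsTestFunction A Z u) (w : G.edgeSet → ℝ) :
    (Function.support fun e => gradient G u e / w e).Finite := by
  refine (finite_support_gradient hG hu.finite_support).subset fun e he => ?_
  contrapose! he
  simp_all

/-- The rescaled gradients of test functions, as a subspace of the space of square summable
functions on edges. -/
def gradientSpace (G : Graph V E) (A Z : Finset V) (r : G.edgeSet → ℝ) :
    Submodule ℝ (lp (fun _ : G.edgeSet => ℝ) 2) where
  carrier := {ψ | ∃ u, IsTestFunction A Z u ∧ ∀ e, ψ e = gradient G u e / √(r e)}
  add_mem' := by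
    rintro φ ψ ⟨u, hu, hφ⟩ ⟨v, hv, hψ⟩
    refine ⟨u + v, ⟨(hu.finite_support.union hv.finite_support).subset
      (Function.support_add u v), fun x hx y hy => ?_, fun x hx y hy => ?_⟩, fun e => ?_⟩
    · rw [Pi.add_apply, Pi.add_apply, hu.const_left x hx y hy, hv.const_left x hx y hy]
    · rw [Pi.add_apply, Pi.add_apply, hu.const_right x hx y hy, hv.const_right x hx y hy]
    · rw [lp.coeFn_add, Pi.add_apply, hφ, hψ]
      simp only [gradient, Pi.add_apply]
      ring
  zero_mem' := ⟨0, ⟨by simp, by simp, by simp⟩, fun e => by simp [gradient]⟩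
  smul_mem' := by
    rintro c ψ ⟨u, hu, hψ⟩
    refine ⟨c • u, ⟨hu.finite_support.subset (Function.support_const_smul_subset c u),
      fun x hx y hy => ?_, fun x hx y hy => ?_⟩, fun e => ?_⟩
    · rw [Pi.smul_apply, Pi.smul_apply, hu.const_left x hx y hy]
    · rw [Pi.smul_apply, Pi.smul_apply, hu.const_right x hx y hy]
    · rw [lp.coeFn_smul, Pi.smul_apply, hψ]
      simp only [gradient, Pi.smul_apply, smul_eq_mul]
      ring

theorem inner_gradient {G : Graph V E} (hG : LocallyFinite G) {A Z : Finset V} {u : V → ℝ}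
    (hu : IsTestFunction A Z u) {r : G.edgeSet → ℝ} {χ ψ : lp (fun _ : G.edgeSet => ℝ) 2}
    (hχ : ∀ e, χ e = gradient G u e / √(r e)) :
    inner ℝ χ ψ = ∑ᶠ e, gradient G u e * (ψ e / √(r e)) := by
  rw [lp_two_inner, tsum_congr fun e => (by rw [hχ e, div_mul_eq_mul_div, mul_div_assoc] :
    χ e * ψ e = gradient G u e * (ψ e / √(r e)))]
  refine tsum_eq_finsum ((finite_support_gradient hG hu.finite_support).subset fun e he => ?_)
  contrapose! he
  simp_all

/-- The truncation of `t` to the interval `[l, h]`. -/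
def clamp (l h t : ℝ) : ℝ := max l (min h t)

theorem monotone_clamp (l h : ℝ) : Monotone (clamp l h) := fun _ _ hst =>
  max_le_max le_rfl (min_le_min le_rfl hst)

theorem clamp_mem {l h : ℝ} (hlh : l ≤ h) (t : ℝ) : l ≤ clamp l h t ∧ clamp l h t ≤ h :=
  ⟨le_max_left _ _, max_le hlh (min_le_left _ _)⟩

theorem clamp_of_mem {l h t : ℝ} (h₁ : l ≤ t) (h₂ : t ≤ h) : clamp l h t = t := by
  rw [clamp, min_eq_right h₂, max_eq_right h₁]

theorem continuous_clamp (l h : ℝ) : Continuous (clamp l h) := by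
  unfold clamp
  fun_prop

theorem abs_clamp_sub_clamp_le (l h s t : ℝ) : |clamp l h s - clamp l h t| ≤ |s - t| := by
  have h1 := abs_max_sub_max_le_max l (min h s) l (min h t)
  have h2 := abs_min_sub_min_le_max h s h t
  rw [sub_self, abs_zero] at h1 h2
  exact (h1.trans_eq (max_eq_right (abs_nonneg _))).trans
    (h2.trans_eq (max_eq_right (abs_nonneg _)))

theorem clamp_sub_clamp_mul_nonneg (l h s t : ℝ) : 0 ≤ (clamp l h s - clamp l h t) * (s - t) := by
  rcases le_total s t with hst | hst
  · exact mul_nonneg_of_nonpos_of_nonpos (sub_nonpos.2 (monotone_clamp l h hst))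
      (sub_nonpos.2 hst)
  · exact mul_nonneg (sub_nonneg.2 (monotone_clamp l h hst)) (sub_nonneg.2 hst)

/-- Subtracting the truncation of `0` keeps the support finite and leaves gradients unchanged. -/
theorem IsTestFunction.clamp {A Z : Finset V} {u : V → ℝ} (hu : IsTestFunction A Z u) (l h : ℝ) :
    IsTestFunction A Z fun x => clamp l h (u x) - ElectricNetwork.clamp l h 0 := by
  refine ⟨hu.finite_support.subset fun x hx => ?_, fun x hx y hy => ?_, fun x hx y hy => ?_⟩
  · contrapose! hx
    simp_all
  · rw [hu.const_left x hx y hy]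
  · rw [hu.const_right x hx y hy]

/-- A square summable limit of rescaled gradients that represents a unit flow carries at most
current one through every edge. -/
theorem abs_le_one_of_mem_closure {G : Graph V E} (hG : LocallyFinite G) {A Z : Finset V}
    (hAZ : Disjoint A Z) (hA : A.Nonempty) (hZ : Z.Nonempty) {r : G.edgeSet → ℝ}
    (hr : ∀ e, 0 < r e) {ψ : lp (fun _ : G.edgeSet => ℝ) 2}
    (hψ : ψ ∈ (gradientSpace G A Z r).topologicalClosure)
    (hflow : IsFlow G A Z 1 fun e => ψ e / √(r e)) (e : G.edgeSet) :
    |ψ e / √(r e)| ≤ 1 := by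
  obtain ⟨x₀, hx₀⟩ := hA
  obtain ⟨z₀, hz₀⟩ := hZ
  rw [isFlow_iff hG hAZ hx₀ hz₀] at hflow
  obtain ⟨φ, hφ, hlim⟩ := mem_closure_iff_seq_limit.1
    (show ψ ∈ closure (gradientSpace G A Z r : Set (lp (fun _ : G.edgeSet => ℝ) 2)) from hψ)
  choose u hu hφu using hφ
  have hs : ∀ e, 0 < √(r e) := fun e => Real.sqrt_pos.2 (hr e)
  -- Truncate the potential of `φ n` between its values at the ends of `e`. The rescaled gradient
  -- `χ` agrees with `φ n` at `e` and never has the opposite sign, so `⟨χ, φ n⟩ ≥ (φ n e)²`. As `ψ`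
  -- comes from a unit flow, `⟨χ, ψ⟩` is a truncated potential drop between the terminals, at most
  -- `√(r e) * |φ n e|`. In the limit `ψ(e)² ≤ √(r e) * |ψ(e)|`.
  have key : ∀ n, (φ n e) ^ 2 ≤ √(r e) * |φ n e| + ‖φ n‖ * ‖φ n - ψ‖ := by
    intro n
    set l := min (u n (tail G e)) (u n (head G e)) with hl
    set h := max (u n (tail G e)) (u n (head G e)) with hh
    have hlh : l ≤ h := min_le_max
    have hd : h - l = |gradient G (u n) e| := by
      rw [hl, hh, gradient, max_sub_min_eq_abs, abs_sub_comm]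
    have ht := (hu n).clamp l h
    set w : V → ℝ := fun x => clamp l h (u n x) - clamp l h 0 with hw
    have hgw : ∀ e, gradient G w e = clamp l h (u n (tail G e)) - clamp l h (u n (head G e)) := by
      intro e
      simp only [gradient, hw]
      ring
    let χ : lp (fun _ : G.edgeSet => ℝ) 2 :=
      ⟨fun e => gradient G w e / √(r e),
        memℓp_two_of_finite_support (finite_support_gradient_div hG ht _)⟩
    have hχ : ∀ e, χ e = gradient G w e / √(r e) := fun e => rfl
    have h1 : inner ℝ χ ψ ≤ |gradient G (u n) e| := by
      rw [inner_gradient hG ht hχ, hflow w ht, ← hd]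
      have a1 := clamp_mem hlh (u n x₀)
      have a2 := clamp_mem hlh (u n z₀)
      simp only [hw]
      linarith
    have h2 : φ n e ^ 2 ≤ inner ℝ χ (φ n) := by
      rw [lp_two_inner]
      have hsum : Summable fun e => χ e * φ n e := by
        have := lp.summable_inner (𝕜 := ℝ) (φ n) χ
        simpa [mul_comm] using this
      have hterm : φ n e ^ 2 = χ e * φ n e := by
        rw [hχ, hgw, clamp_of_mem (min_le_left _ _) (le_max_left _ _),
          clamp_of_mem (min_le_right _ _) (le_max_right _ _), hφu n e, gradient]
        ring
      rw [hterm]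
      refine hsum.le_tsum e fun e' _ => ?_
      rw [hχ, hgw, hφu n e', div_mul_div_comm]
      exact div_nonneg (clamp_sub_clamp_mul_nonneg l h _ _) (mul_self_nonneg _)
    have h3 : ‖χ‖ ≤ ‖φ n‖ := by
      refine le_of_sq_le_sq ?_ (norm_nonneg _)
      rw [lp_two_norm_sq, lp_two_norm_sq]
      refine (memℓp_two_iff.1 (lp.memℓp χ)).tsum_le_tsum (fun e' => ?_)
        (memℓp_two_iff.1 (lp.memℓp (φ n)))
      rw [hχ, hgw, hφu n e', div_pow, div_pow]
      gcongr ?_ / _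
      exact sq_le_sq.2 (abs_clamp_sub_clamp_le l h _ _)
    have h4 : inner ℝ χ (φ n) - inner ℝ χ ψ ≤ ‖φ n‖ * ‖φ n - ψ‖ := by
      rw [← inner_sub_right]
      exact (real_inner_le_norm _ _).trans (by gcongr)
    have h5 : |gradient G (u n) e| = √(r e) * |φ n e| := by
      rw [hφu n e, abs_div, abs_of_pos (hs e)]
      field_simp [(hs e).ne']
    linarith
  have hφe : Filter.Tendsto (fun n => φ n e) Filter.atTop (nhds (ψ e)) := by
    have h1 : Filter.Tendsto (fun n => ‖φ n - ψ‖) Filter.atTop (nhds 0) :=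
      tendsto_iff_norm_sub_tendsto_zero.1 hlim
    refine tendsto_iff_norm_sub_tendsto_zero.2 (squeeze_zero (fun _ => norm_nonneg _)
      (fun n => ?_) h1)
    exact lp.norm_apply_le_norm (by norm_num) (φ n - ψ) e
  have hlim2 := le_of_tendsto_of_tendsto' (hφe.pow 2)
    ((hφe.abs.const_mul (√(r e))).add
      (hlim.norm.mul (tendsto_iff_norm_sub_tendsto_zero.1 hlim))) key
  rw [mul_zero, add_zero, ← sq_abs] at hlim2
  rw [abs_div, abs_of_pos (hs e), div_le_one (hs e)]
  by_contra hlt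
  push Not at hlt
  nlinarith [abs_nonneg (ψ e), hs e]

/-- `θ` is a unit flow of finite energy with current at most one through every edge, and the energy
of every other unit flow exceeds that of `θ` by the energy of the difference. -/
structure IsPythagoreanFlow (G : Graph V E) (A Z : Finset V) (r θ : G.edgeSet → ℝ) : Prop where
  isFlow : IsFlow G A Z 1 θ
  summable : Summable fun e => r e * θ e ^ 2
  abs_le_one : ∀ e, |θ e| ≤ 1
  hasSum_sub : ∀ φ, IsFlow G A Z 1 φ → Summable (fun e => r e * φ e ^ 2) →
    HasSum (fun e => r e * (φ e - θ e) ^ 2) (∑' e, r e * φ e ^ 2 - ∑' e, r e * θ e ^ 2)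

/-- After multiplication by `√r` the energy is the squared `ℓ²` norm, and differences of unit flows
are exactly the vectors orthogonal to the gradients. So projecting any unit flow of finite energy
onto the closed gradient space gives a unit flow orthogonal to all such differences, and Pythagoras
applies. -/
theorem exists_isPythagoreanFlow {G : Graph V E} (hG : LocallyFinite G) {A Z : Finset V}
    (hAZ : Disjoint A Z) (hA : A.Nonempty) (hZ : Z.Nonempty) {r : G.edgeSet → ℝ}
    (hr : ∀ e, 0 < r e) {φ₀ : G.edgeSet → ℝ} (hφ₀ : IsFlow G A Z 1 φ₀)
    (hφ₀r : Summable fun e => r e * φ₀ e ^ 2) :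
    ∃ θ, IsPythagoreanFlow G A Z r θ := by
  have hA' := hA
  have hZ' := hZ
  obtain ⟨x₀, hx₀⟩ := hA'
  obtain ⟨z₀, hz₀⟩ := hZ'
  have hs : ∀ e, 0 < √(r e) := fun e => Real.sqrt_pos.2 (hr e)
  have hsq : ∀ φ : G.edgeSet → ℝ, (fun e => (√(r e) * φ e) ^ 2) = fun e => r e * φ e ^ 2 := by
    intro φ
    ext e
    rw [mul_pow, Real.sq_sqrt (hr e).le]
  have hmem : ∀ {φ : G.edgeSet → ℝ}, Summable (fun e => r e * φ e ^ 2) →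
      Memℓp (fun e => √(r e) * φ e) 2 := by
    intro φ h
    rw [memℓp_two_iff, hsq]
    exact h
  have hcancel : ∀ φ : G.edgeSet → ℝ, (fun e => √(r e) * φ e / √(r e)) = φ := by
    intro φ
    ext e
    rw [mul_div_cancel_left₀ _ (hs e).ne']
  set S := gradientSpace G A Z r with hS
  set K := S.topologicalClosure with hK
  have : K.HasOrthogonalProjection := by
    have : CompleteSpace K := S.isClosed_topologicalClosure.completeSpace_coe
    infer_instance
  have orth : ∀ {ξ ψ : lp (fun _ : G.edgeSet => ℝ) 2}, IsFlow G A Z 1 (fun e => ξ e / √(r e)) →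
      (ξ - ψ ∈ Kᗮ ↔ IsFlow G A Z 1 fun e => ψ e / √(r e)) := by
    intro ξ ψ hξ
    rw [isFlow_iff hG hAZ hx₀ hz₀] at hξ ⊢
    rw [hK, Submodule.orthogonal_closure, Submodule.mem_orthogonal]
    constructor
    · intro H u hu
      let χ : lp (fun _ : G.edgeSet => ℝ) 2 :=
        ⟨fun e => gradient G u e / √(r e),
          memℓp_two_of_finite_support (finite_support_gradient_div hG hu _)⟩
      have h1 := H χ ⟨u, hu, fun _ => rfl⟩
      rw [inner_sub_right, inner_gradient hG hu (fun _ => rfl),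
        inner_gradient hG hu (fun _ => rfl), hξ u hu] at h1
      linarith
    · rintro H χ ⟨u, hu, hχ⟩
      rw [inner_sub_right, inner_gradient hG hu hχ, inner_gradient hG hu hχ, hξ u hu, H u hu,
        sub_self]
  let ψ₀ : lp (fun _ : G.edgeSet => ℝ) 2 := ⟨fun e => √(r e) * φ₀ e, hmem hφ₀r⟩
  have hψ₀ : IsFlow G A Z 1 fun e => ψ₀ e / √(r e) := by
    rw [← hcancel φ₀] at hφ₀
    exact hφ₀
  set ψ := K.starProjection ψ₀ with hψdef
  have hψK : ψ ∈ K := Submodule.starProjection_apply_mem K ψ₀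
  have hψ : IsFlow G A Z 1 fun e => ψ e / √(r e) :=
    (orth hψ₀).1 (Submodule.sub_starProjection_mem_orthogonal ψ₀)
  have hψsq : (fun e => r e * (ψ e / √(r e)) ^ 2) = fun e => ψ e ^ 2 := by
    ext e
    rw [div_pow, Real.sq_sqrt (hr e).le, mul_div_cancel₀ _ (hr e).ne']
  refine ⟨fun e => ψ e / √(r e), hψ, ?_, abs_le_one_of_mem_closure hG hAZ hA hZ hr hψK hψ, ?_⟩
  · rw [hψsq]
    exact memℓp_two_iff.1 (lp.memℓp ψ)
  · intro φ hφ hφr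
    let ξ : lp (fun _ : G.edgeSet => ℝ) 2 := ⟨fun e => √(r e) * φ e, hmem hφr⟩
    have hξ : IsFlow G A Z 1 fun e => ξ e / √(r e) := by
      rw [← hcancel φ] at hφ
      exact hφ
    have ho : inner ℝ ψ (ξ - ψ) = 0 :=
      (Submodule.mem_orthogonal _ _).1 ((orth hξ).2 hψ) ψ hψK
    have hn : ‖ξ - ψ‖ ^ 2 = ‖ξ‖ ^ 2 - ‖ψ‖ ^ 2 := by
      have h1 : ξ = ψ + (ξ - ψ) := by abel
      have h2 := norm_add_sq_real ψ (ξ - ψ)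
      rw [← h1, ho] at h2
      linarith
    have hpt : (fun e => r e * (φ e - ψ e / √(r e)) ^ 2) = fun e => (ξ - ψ) e ^ 2 := by
      ext e
      have : (ξ - ψ) e = √(r e) * (φ e - ψ e / √(r e)) := by
        rw [lp.coeFn_sub, Pi.sub_apply, mul_sub, mul_div_cancel₀ _ (hs e).ne']
      rw [this, mul_pow, Real.sq_sqrt (hr e).le]
    rw [hψsq, hpt, ← hsq φ, ← lp_two_norm_sq ψ,
      (show ∑' e, (√(r e) * φ e) ^ 2 = ‖ξ‖ ^ 2 from (lp_two_norm_sq ξ).symm), ← hn,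
      lp_two_norm_sq]
    exact (memℓp_two_iff.1 (lp.memℓp (ξ - ψ))).hasSum

end ElectricNetwork

/-! ### Uniqueness of the minimal flow and its dependence on the resistances. -/

namespace ElectricNetwork

variable {V E : Type*}

section MinimalFlow

variable {G : Graph V E} {A Z : Finset V} {r s θ φ : G.edgeSet → ℝ} {a b : ℝ}

theorem energy_of_summable (hr : ∀ e, 0 < r e) (h : Summable fun e => r e * θ e ^ 2) :
    energy G r θ = ENNReal.ofReal (∑' e, r e * θ e ^ 2) :=
  (ENNReal.ofReal_tsum_of_nonneg (fun e => mul_nonneg (hr e).le (sq_nonneg _)) h).symm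

theorem summable_of_energy_ne_top (hr : ∀ e, 0 < r e) (h : energy G r θ ≠ ⊤) :
    Summable fun e => r e * θ e ^ 2 := by
  refine (ENNReal.summable_toReal h).congr fun e => ?_
  rw [ENNReal.toReal_ofReal (mul_nonneg (hr e).le (sq_nonneg _))]

theorem IsPythagoreanFlow.tsum_le (hr : ∀ e, 0 < r e) (hθ : IsPythagoreanFlow G A Z r θ)
    (hφ : IsFlow G A Z 1 φ) (hφr : Summable fun e => r e * φ e ^ 2) :
    ∑' e, r e * θ e ^ 2 ≤ ∑' e, r e * φ e ^ 2 :=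
  sub_nonneg.1 ((hθ.hasSum_sub φ hφ hφr).nonneg fun e => mul_nonneg (hr e).le (sq_nonneg _))

theorem IsPythagoreanFlow.isMinimalFlow (hr : ∀ e, 0 < r e)
    (hθ : IsPythagoreanFlow G A Z r θ) : IsMinimalFlow G A Z r θ := by
  refine ⟨hθ.isFlow, le_antisymm ?_ (iInf₂_le θ hθ.isFlow)⟩
  refine le_iInf₂ fun φ hφ => ?_
  by_cases h : energy G r φ = ⊤
  · rw [h]
    exact le_top
  have hs := summable_of_energy_ne_top hr h
  rw [energy_of_summable hr hθ.summable, energy_of_summable hr hs]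
  exact ENNReal.ofReal_le_ofReal (hθ.tsum_le hr hφ hs)

theorem IsPythagoreanFlow.eq_of_isMinimalFlow (hr : ∀ e, 0 < r e)
    (hθ : IsPythagoreanFlow G A Z r θ) (hφ : IsMinimalFlow G A Z r φ) : φ = θ := by
  have he : energy G r φ = energy G r θ := hφ.2.trans (hθ.isMinimalFlow hr).2.symm
  have hs : Summable fun e => r e * φ e ^ 2 := by
    refine summable_of_energy_ne_top hr ?_
    rw [he, energy_of_summable hr hθ.summable]
    exact ENNReal.ofReal_ne_top
  have hn : ∀ ψ : G.edgeSet → ℝ, 0 ≤ ∑' e, r e * ψ e ^ 2 := fun ψ =>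
    tsum_nonneg fun e => mul_nonneg (hr e).le (sq_nonneg _)
  rw [energy_of_summable hr hs, energy_of_summable hr hθ.summable,
    ENNReal.ofReal_eq_ofReal_iff (hn _) (hn _)] at he
  have h0 := hθ.hasSum_sub φ hφ.1 hs
  rw [he, sub_self,
    hasSum_zero_iff_of_nonneg fun e => mul_nonneg (hr e).le (sq_nonneg _)] at h0
  ext e
  have h1 : r e * (φ e - θ e) ^ 2 = 0 := congrFun h0 e
  rcases mul_eq_zero.1 h1 with h | h
  · exact absurd h (hr e).ne'
  · exact sub_eq_zero.1 (pow_eq_zero_iff two_ne_zero |>.1 h)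

theorem isPythagoreanFlow_minimalFlow (hG : LocallyFinite G) (hAZ : Disjoint A Z)
    (hA : A.Nonempty) (hZ : Z.Nonempty) (ha : 0 < a) (hr : ∀ e, r e ∈ Set.Icc a b)
    (hφ : IsFlow G A Z 1 φ) (hφs : Summable fun e => φ e ^ 2) :
    IsPythagoreanFlow G A Z r (minimalFlow G A Z r) := by
  have hr0 : ∀ e, 0 < r e := fun e => ha.trans_le (hr e).1
  have hs : Summable fun e => r e * φ e ^ 2 :=
    Summable.of_nonneg_of_le (fun e => mul_nonneg (hr0 e).le (sq_nonneg _))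
      (fun e => mul_le_mul_of_nonneg_right (hr e).2 (sq_nonneg _)) (hφs.mul_left b)
  obtain ⟨θ, hθ⟩ := exists_isPythagoreanFlow hG hAZ hA hZ hr0 hφ hs
  have hex : ∃ θ, IsMinimalFlow G A Z r θ := ⟨θ, hθ.isMinimalFlow hr0⟩
  rw [minimalFlow, dif_pos hex, hθ.eq_of_isMinimalFlow hr0 hex.choose_spec]
  exact hθ

theorem IsPythagoreanFlow.effectiveResistance_eq (hr : ∀ e, 0 < r e)
    (hθ : IsPythagoreanFlow G A Z r θ) :
    effectiveResistance G A Z r = ∑' e, r e * θ e ^ 2 := by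
  rw [effectiveResistance, ← (hθ.isMinimalFlow hr).2, energy_of_summable hr hθ.summable,
    ENNReal.toReal_ofReal (tsum_nonneg fun e => mul_nonneg (hr e).le (sq_nonneg _))]

theorem IsPythagoreanFlow.summable_sq (ha : 0 < a) (hr : ∀ e, r e ∈ Set.Icc a b)
    (hθ : IsPythagoreanFlow G A Z r θ) : Summable fun e => θ e ^ 2 := by
  refine Summable.of_nonneg_of_le (fun e => sq_nonneg _) (fun e => ?_)
    (hθ.summable.mul_left a⁻¹)
  rw [inv_mul_eq_div, le_div_iff₀ ha, mul_comm]
  exact mul_le_mul_of_nonneg_right (hr e).1 (sq_nonneg _)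

theorem summable_mul_sq (ha : 0 < a) (hr : ∀ e, r e ∈ Set.Icc a b)
    (hφ : Summable fun e => φ e ^ 2) : Summable fun e => r e * φ e ^ 2 :=
  Summable.of_nonneg_of_le (fun e => mul_nonneg (ha.le.trans (hr e).1) (sq_nonneg _))
    (fun e => mul_le_mul_of_nonneg_right (hr e).2 (sq_nonneg _)) (hφ.mul_left b)

theorem IsPythagoreanFlow.effectiveResistance_pos (hr : ∀ e, 0 < r e)
    (hθ : IsPythagoreanFlow G A Z r θ) : 0 < effectiveResistance G A Z r := by
  have hnn : ∀ e, 0 ≤ r e * θ e ^ 2 := fun e => mul_nonneg (hr e).le (sq_nonneg _)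
  rw [hθ.effectiveResistance_eq hr]
  refine lt_of_le_of_ne (tsum_nonneg hnn) fun h0 => ?_
  have h1 := hθ.summable.hasSum
  rw [← h0, hasSum_zero_iff_of_nonneg hnn] at h1
  have hz : θ = 0 := by
    ext e
    rcases mul_eq_zero.1 (congrFun h1 e) with h | h
    · exact absurd h (hr e).ne'
    · exact pow_eq_zero_iff two_ne_zero |>.1 h
  have h2 := hθ.isFlow.flow_out
  rw [hz] at h2
  simp [outflow] at h2

/-- The energy of the change of the minimal flow under a change of resistances. -/
theorem IsPythagoreanFlow.tsum_sub_le (ha : 0 < a) (hr : ∀ e, r e ∈ Set.Icc a b)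
    (hs : ∀ e, s e ∈ Set.Icc a b) (hθ : IsPythagoreanFlow G A Z r θ)
    (hφ : IsPythagoreanFlow G A Z s φ) :
    ∑' e, s e * (θ e - φ e) ^ 2 ≤ a⁻¹ * ∑' e, (s e - r e) ^ 2 * θ e ^ 2 := by
  have hθs := hθ.summable_sq ha hr
  have hφs := hφ.summable_sq ha hs
  have h1 := hφ.hasSum_sub θ hθ.isFlow (summable_mul_sq ha hs hθs)
  have h2 := hθ.hasSum_sub φ hφ.isFlow (summable_mul_sq ha hr hφs)
  have e1 := (summable_mul_sq ha hs hθs).hasSum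
  have e2 := (summable_mul_sq ha hr hθs).hasSum
  have e3 := (summable_mul_sq ha hs hφs).hasSum
  have e4 := (summable_mul_sq ha hr hφs).hasSum
  have hsum : Summable fun e => (s e - r e) ^ 2 * θ e ^ 2 := by
    refine Summable.of_nonneg_of_le (fun e => by positivity) (fun e => ?_)
      (hθs.mul_left ((b - a) ^ 2))
    refine mul_le_mul_of_nonneg_right ?_ (sq_nonneg _)
    refine sq_le_sq' ?_ ?_ <;> linarith [(hr e).1, (hr e).2, (hs e).1, (hs e).2]
  have h3 := hsum.hasSum.mul_left a⁻¹
  rw [h1.tsum_eq]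
  -- With `D = θ - φ`, the two Pythagorean identities say that the terms `2sD² - 2(s - r)θD` sum to
  -- zero. Completing the square in `2(s - r)θD ≤ sD² + (s - r)²θ²/s` and using `s ≥ a` finishes.
  have hz := (h1.add h2).sub (((e1.sub e3).add (e4.sub e2)))
  have hfin := (h3.sub h1).add hz
  have := hfin.nonneg fun e => ?_
  · linarith
  have hsa := (hs e).1
  have hs0 : 0 < s e := ha.trans_le hsa
  have h5 : (s e - r e) ^ 2 * θ e ^ 2 * (s e)⁻¹ ≤ a⁻¹ * ((s e - r e) ^ 2 * θ e ^ 2) := by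
    rw [mul_comm]
    gcongr
  have h6 : 0 ≤ (s e)⁻¹ * (s e * (θ e - φ e) - (s e - r e) * θ e) ^ 2 := by positivity
  have h7 : (s e)⁻¹ * (s e * (θ e - φ e) - (s e - r e) * θ e) ^ 2
      = s e * (θ e - φ e) ^ 2 - 2 * ((s e - r e) * θ e * (θ e - φ e))
        + (s e - r e) ^ 2 * θ e ^ 2 * (s e)⁻¹ := by
    field_simp
    ring
  nlinarith

end MinimalFlow

section Continuity

variable {G : Graph V E} {A Z : Finset V} {a b : ℝ}

/-- Coordinatewise convergence is enough: the stability bound involves only `∑ (s_i - r)² θ²` with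
`θ` fixed, which tends to zero by dominated convergence. -/
theorem tendsto_minimalFlow (hG : LocallyFinite G) (hAZ : Disjoint A Z)
    (hA : A.Nonempty) (hZ : Z.Nonempty) (ha : 0 < a)
    {φ : G.edgeSet → ℝ} (hφ : IsFlow G A Z 1 φ) (hφs : Summable fun e => φ e ^ 2)
    {ι : Type*} {l : Filter ι} {s : ι → G.edgeSet → ℝ} {r : G.edgeSet → ℝ}
    (hr : ∀ e, r e ∈ Set.Icc a b) (hs : ∀ i e, s i e ∈ Set.Icc a b)
    (h : Filter.Tendsto s l (nhds r)) :
    (∀ e, Filter.Tendsto (fun i => minimalFlow G A Z (s i) e) l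
      (nhds (minimalFlow G A Z r e))) ∧
    Filter.Tendsto (fun i => effectiveResistance G A Z (s i)) l
      (nhds (effectiveResistance G A Z r)) := by
  have hθ := isPythagoreanFlow_minimalFlow hG hAZ hA hZ ha hr hφ hφs
  have hη := fun i => isPythagoreanFlow_minimalFlow hG hAZ hA hZ ha (hs i) hφ hφs
  set θ := minimalFlow G A Z r with hθdef
  set η := fun i => minimalFlow G A Z (s i) with hηdef
  have hθs := hθ.summable_sq ha hr
  have hpt : ∀ e, Filter.Tendsto (fun i => s i e) l (nhds (r e)) := tendsto_pi_nhds.1 h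
  have hlim : Filter.Tendsto (fun i => ∑' e, (s i e - r e) ^ 2 * θ e ^ 2) l (nhds 0) := by
    have := tendsto_tsum_of_dominated_convergence (𝓕 := l)
      (f := fun i e => (s i e - r e) ^ 2 * θ e ^ 2) (g := fun _ => 0)
      (bound := fun e => (b - a) ^ 2 * θ e ^ 2) (hθs.mul_left _) (fun e => ?_)
      (Filter.Eventually.of_forall fun i e => ?_)
    · simpa using this
    · have := (((hpt e).sub_const (r e)).pow 2).mul_const (θ e ^ 2)
      simpa using this
    · rw [Real.norm_of_nonneg (by positivity)]
      refine mul_le_mul_of_nonneg_right ?_ (sq_nonneg _)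
      refine sq_le_sq' ?_ ?_ <;> linarith [(hr e).1, (hr e).2, (hs i e).1, (hs i e).2]
  have hpos : ∀ i e, 0 < s i e := fun i e => ha.trans_le (hs i e).1
  have hbound := fun i => hθ.tsum_sub_le ha hr (hs i) (hη i)
  have hsub := fun i => (hη i).hasSum_sub θ hθ.isFlow (summable_mul_sq ha (hs i) hθs)
  have hlim2 : Filter.Tendsto (fun i => ∑' e, s i e * (θ e - η i e) ^ 2) l (nhds 0) := by
    refine squeeze_zero (fun i => tsum_nonneg fun e => mul_nonneg (hpos i e).le (sq_nonneg _))
      hbound ?_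
    simpa using hlim.const_mul a⁻¹
  constructor
  · intro e
    have h1 : ∀ i, (η i e - θ e) ^ 2 ≤ a⁻¹ * ∑' e, s i e * (θ e - η i e) ^ 2 := by
      intro i
      have h2 := (hsub i).summable.le_tsum e fun e _ => mul_nonneg (hpos i e).le (sq_nonneg _)
      rw [inv_mul_eq_div, le_div_iff₀ ha]
      nlinarith [mul_le_mul_of_nonneg_right (hs i e).1 (sq_nonneg (θ e - η i e))]
    have h3 : Filter.Tendsto (fun i => (η i e - θ e) ^ 2) l (nhds 0) :=
      squeeze_zero (fun i => sq_nonneg _) h1 (by simpa using hlim2.const_mul a⁻¹)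
    have h4 := h3.sqrt
    simp only [Real.sqrt_sq_eq_abs, Real.sqrt_zero] at h4
    exact tendsto_iff_norm_sub_tendsto_zero.2 h4
  · have h1 : ∀ i, effectiveResistance G A Z (s i)
        = ∑' e, s i e * θ e ^ 2 - ∑' e, s i e * (θ e - η i e) ^ 2 := by
      intro i
      rw [(hη i).effectiveResistance_eq (hpos i), (hsub i).tsum_eq]
      ring
    rw [hθ.effectiveResistance_eq fun e => ha.trans_le (hr e).1]
    simp only [h1]
    have h2 : Filter.Tendsto (fun i => ∑' e, s i e * θ e ^ 2) l
        (nhds (∑' e, r e * θ e ^ 2)) := by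
      refine tendsto_tsum_of_dominated_convergence (bound := fun e => b * θ e ^ 2)
        (hθs.mul_left _) (fun e => (hpt e).mul_const _)
        (Filter.Eventually.of_forall fun i e => ?_)
      rw [Real.norm_of_nonneg (mul_nonneg (hpos i e).le (sq_nonneg _))]
      exact mul_le_mul_of_nonneg_right (hs i e).2 (sq_nonneg _)
    simpa using h2.sub hlim2

end Continuity

section Resampling

variable {G : Graph V E} {A Z : Finset V} {a b : ℝ}

/-- The minimal flow for `r` is a competitor for the modified resistances, and its energy changes
only at `e`. -/
theorem effectiveResistance_update_le [DecidableEq G.edgeSet] (hG : LocallyFinite G)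
    (hAZ : Disjoint A Z) (hA : A.Nonempty) (hZ : Z.Nonempty) (ha : 0 < a)
    {φ : G.edgeSet → ℝ} (hφ : IsFlow G A Z 1 φ) (hφs : Summable fun e => φ e ^ 2)
    {r : G.edgeSet → ℝ} (hr : ∀ e, r e ∈ Set.Icc a b) (e : G.edgeSet) {t : ℝ}
    (ht : t ∈ Set.Icc a b) :
    effectiveResistance G A Z (Function.update r e t)
      ≤ effectiveResistance G A Z r + (t - r e) * minimalFlow G A Z r e ^ 2 := by
  have hr' : ∀ e', Function.update r e t e' ∈ Set.Icc a b := by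
    intro e'
    rcases eq_or_ne e' e with rfl | h
    · simpa using ht
    · simpa [h] using hr e'
  have hθ := isPythagoreanFlow_minimalFlow hG hAZ hA hZ ha hr hφ hφs
  have hη := isPythagoreanFlow_minimalFlow hG hAZ hA hZ ha hr' hφ hφs
  have hθs := hθ.summable_sq ha hr
  have hpos : ∀ e', 0 < Function.update r e t e' := fun e' => ha.trans_le (hr' e').1
  rw [hη.effectiveResistance_eq hpos, hθ.effectiveResistance_eq fun e => ha.trans_le (hr e).1]
  refine (hη.tsum_le hpos hθ.isFlow (summable_mul_sq ha hr' hθs)).trans_eq ?_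
  set θ := minimalFlow G A Z r
  have h1 := (summable_mul_sq ha hr' hθs).hasSum.sub hθ.summable.hasSum
  have h2 := h1.unique (hasSum_single e fun e' he' => by simp [he'])
  simp only [Function.update_self] at h2
  linarith

end Resampling

end ElectricNetwork

/-! ### The product law and resampling of coordinates. -/

namespace ElectricNetwork

instance isProbabilityMeasure_bernoulliLaw (a b : ℝ) : IsProbabilityMeasure (bernoulliLaw a b) := by
  refine ⟨?_⟩
  simp [bernoulliLaw, ENNReal.inv_two_add_inv_two]

theorem bernoulliLaw_apply (a b : ℝ) {s : Set ℝ} (hs : MeasurableSet s) :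
    bernoulliLaw a b s = 2⁻¹ * s.indicator 1 a + 2⁻¹ * s.indicator 1 b := by
  simp [bernoulliLaw, hs]

/-- The law of a family of independent variables with law `½ δ_a + ½ δ_b`. -/
noncomputable def productLaw (ι : Type*) (a b : ℝ) : Measure (ι → ℝ) :=
  Measure.infinitePi fun _ => bernoulliLaw a b

instance isProbabilityMeasure_productLaw (ι : Type*) (a b : ℝ) :
    IsProbabilityMeasure (productLaw ι a b) := by
  unfold productLaw
  infer_instance

section ProductLaw

variable {ι : Type*} {a b : ℝ}

theorem ae_productLaw_mem [Countable ι] :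
    ∀ᵐ y ∂productLaw ι a b, ∀ i, y i = a ∨ y i = b := by
  rw [ae_all_iff]
  intro i
  have h : ∀ᵐ t ∂bernoulliLaw a b, t = a ∨ t = b := by
    rw [ae_iff, bernoulliLaw_apply]
    · simp
    · exact (((measurableSet_singleton a).union (measurableSet_singleton b))).compl
  exact (measurePreserving_eval_infinitePi (fun _ : ι => bernoulliLaw a b)
    i).quasiMeasurePreserving.ae h

theorem measurable_update_const [DecidableEq ι] (i : ι) (t : ℝ) :
    Measurable fun y : ι → ℝ => Function.update y i t := by
  refine measurable_pi_lambda _ fun j => ?_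
  rcases eq_or_ne j i with rfl | h
  · simp
  · simpa [h] using measurable_pi_apply j

theorem continuous_update_const [DecidableEq ι] (i : ι) (t : ℝ) :
    Continuous fun y : ι → ℝ => Function.update y i t :=
  continuous_id.update i continuous_const

/-- Overwriting one coordinate by an independent fair choice preserves the law; finite-dimensional
boxes determine a product measure, so only they are checked. -/
theorem productLaw_eq_resample [DecidableEq ι] (i : ι) :
    productLaw ι a b
      = (2⁻¹ : ℝ≥0∞) • (productLaw ι a b).map (fun y => Function.update y i a)
        + (2⁻¹ : ℝ≥0∞) • (productLaw ι a b).map (fun y => Function.update y i b) := by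
  symm
  refine Measure.eq_infinitePi _ fun s t ht => ?_
  have hpi : MeasurableSet ((s : Set ι).pi t) :=
    MeasurableSet.pi s.countable_toSet fun j _ => ht j
  have hmap : ∀ c : ℝ, (productLaw ι a b).map (fun y => Function.update y i c) ((s : Set ι).pi t)
      = (if i ∈ s then (t i).indicator 1 c else 1) * ∏ j ∈ s.erase i, bernoulliLaw a b (t j) := by
    intro c
    rw [Measure.map_apply (measurable_update_const i c) hpi]
    have hpre : (fun y : ι → ℝ => Function.update y i c) ⁻¹' ((s : Set ι).pi t)
        = {y | i ∈ s → c ∈ t i} ∩ ((s.erase i : Finset ι) : Set ι).pi t := by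
      ext y
      simp only [Set.mem_preimage, Set.mem_pi, Set.mem_inter_iff, Set.mem_ofPred_eq,
        Finset.coe_erase, Set.mem_sdiff, Set.mem_singleton_iff, Finset.mem_coe]
      constructor
      · intro h
        refine ⟨fun hi => by simpa using h i hi, fun j hj => by simpa [hj.2] using h j hj.1⟩
      · rintro ⟨h1, h2⟩ j hj
        rcases eq_or_ne j i with rfl | hji
        · simpa using h1 hj
        · simpa [hji] using h2 j ⟨hj, hji⟩
    rw [hpre]
    by_cases hi : i ∈ s
    · by_cases hc : c ∈ t i
      · have : {y : ι → ℝ | i ∈ s → c ∈ t i} = Set.univ := by ext; simp [hc]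
        rw [this, Set.univ_inter, productLaw, Measure.infinitePi_pi _ fun j _ => ht j]
        simp [hi, hc]
      · have : {y : ι → ℝ | i ∈ s → c ∈ t i} = ∅ := by ext; simp [hc, hi]
        rw [this, Set.empty_inter]
        simp [hi, hc]
    · have : {y : ι → ℝ | i ∈ s → c ∈ t i} = Set.univ := by ext; simp [hi]
      rw [this, Set.univ_inter, productLaw, Measure.infinitePi_pi _ fun j _ => ht j]
      simp [hi]
  rw [Measure.add_apply, Measure.smul_apply, Measure.smul_apply, hmap, hmap, smul_eq_mul,
    smul_eq_mul, ← mul_assoc, ← mul_assoc, ← add_mul]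
  by_cases hi : i ∈ s
  · rw [if_pos hi, if_pos hi, ← Finset.mul_prod_erase s _ hi, bernoulliLaw_apply a b (ht i)]
  · rw [if_neg hi, if_neg hi, mul_one, ENNReal.inv_two_add_inv_two, one_mul,
      Finset.erase_eq_of_notMem hi]

theorem integrable_of_abs_le {Ω : Type*} [MeasurableSpace Ω] {μ : Measure Ω} [IsFiniteMeasure μ]
    {g : Ω → ℝ} (hg : Measurable g) {M : ℝ} (hM : ∀ y, |g y| ≤ M) : Integrable g μ :=
  Integrable.of_bound hg.aestronglyMeasurable M (Filter.Eventually.of_forall hM)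

theorem integral_resample [DecidableEq ι] (i : ι) {g : (ι → ℝ) → ℝ} (hg : Measurable g) {M : ℝ}
    (hM : ∀ y, |g y| ≤ M) :
    ∫ y, g y ∂productLaw ι a b = (∫ y, g (Function.update y i a) ∂productLaw ι a b
      + ∫ y, g (Function.update y i b) ∂productLaw ι a b) / 2 := by
  have hi : ∀ c : ℝ, Integrable g
      ((2⁻¹ : ℝ≥0∞) • (productLaw ι a b).map (fun y => Function.update y i c)) := by
    intro c
    have : IsProbabilityMeasure ((productLaw ι a b).map (fun y => Function.update y i c)) :=
      Measure.isProbabilityMeasure_map (measurable_update_const i c).aemeasurable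
    exact (integrable_of_abs_le hg hM).smul_measure (by simp)
  conv_lhs => rw [productLaw_eq_resample i]
  rw [integral_add_measure (hi a) (hi b), integral_smul_measure, integral_smul_measure,
    integral_map (measurable_update_const i a).aemeasurable hg.aestronglyMeasurable,
    integral_map (measurable_update_const i b).aemeasurable hg.aestronglyMeasurable]
  simp
  ring

/-- The values `a` and `b` encoded by a bit. -/
def bitValue (a b : ℝ) (c : Bool) : ℝ := bif c then b else a

theorem continuous_extend_uncurry {n : ℕ} (e : Fin n → ι) :
    Continuous fun p : (Fin n → ℝ) × (ι → ℝ) => Function.extend e p.1 p.2 := by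
  classical
  refine continuous_pi fun i => ?_
  by_cases h : ∃ k, e k = i
  · simp only [Function.extend, h, dif_pos]
    fun_prop
  · simp only [Function.extend, h, dif_neg, not_false_eq_true]
    fun_prop

theorem continuous_extend_right {n : ℕ} (e : Fin n → ι) (v : Fin n → ℝ) :
    Continuous fun y : ι → ℝ => Function.extend e v y :=
  (continuous_extend_uncurry e).comp (by fun_prop : Continuous fun y : ι → ℝ => (v, y))

theorem extend_update [DecidableEq ι] {n : ℕ} {e : Fin n → ι} (he : Function.Injective e)
    (v : Fin n → ℝ) (k : Fin n) (t : ℝ) (y : ι → ℝ) :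
    Function.extend e (Function.update v k t) y
      = Function.update (Function.extend e v y) (e k) t := by
  ext i
  by_cases h : ∃ j, e j = i
  · obtain ⟨j, rfl⟩ := h
    rw [he.extend_apply]
    rcases eq_or_ne j k with rfl | hjk
    · simp
    · simp [hjk, he.ne hjk, he.extend_apply]
  · have hik : i ≠ e k := fun hik => h ⟨k, hik.symm⟩
    rw [Function.extend_apply' _ _ _ h, Function.update_of_ne hik,
      Function.extend_apply' _ _ _ h]

theorem extend_cons [DecidableEq ι] {n : ℕ} {e : Fin (n + 1) → ι} (he : Function.Injective e)
    (x : Fin n → Bool) (c : Bool) (y : ι → ℝ) :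
    Function.extend e (fun k => bitValue a b ((Fin.cons c x : Fin (n + 1) → Bool) k)) y
      = Function.update (Function.extend (fun k => e (Fin.succ k)) (fun k => bitValue a b (x k)) y)
        (e 0) (bitValue a b c) := by
  have he' : Function.Injective fun k : Fin n => e k.succ := he.comp (Fin.succ_injective n)
  ext i
  by_cases h : ∃ j, e j = i
  · obtain ⟨j, rfl⟩ := h
    rw [he.extend_apply]
    refine Fin.cases ?_ (fun j => ?_) j
    · simp
    · rw [Function.update_of_ne (he.ne (Fin.succ_ne_zero j))]
      exact (he'.extend_apply (fun k => bitValue a b (x k)) y j).symm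
  · have h0 : i ≠ e 0 := fun h0 => h ⟨0, h0.symm⟩
    rw [Function.extend_apply' _ _ _ h, Function.update_of_ne h0, Function.extend_apply']
    rintro ⟨k, hk⟩
    exact h ⟨_, hk⟩

open BooleanCube in
/-- Resampling finitely many coordinates does not change the mean. -/
theorem avg_integral_extend {n : ℕ} {e : Fin n → ι} (he : Function.Injective e)
    {g : (ι → ℝ) → ℝ} (hg : Measurable g) {M : ℝ} (hM : ∀ y, |g y| ≤ M) :
    avg (fun x => ∫ y, g (Function.extend e (fun k => bitValue a b (x k)) y) ∂productLaw ι a b)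
      = ∫ y, g y ∂productLaw ι a b := by
  classical
  induction n generalizing g with
  | zero =>
    rw [avg_zero _ default]
    have : ∀ y : ι → ℝ,
        Function.extend e (fun k => bitValue a b ((default : Fin 0 → Bool) k)) y = y :=
      fun y => funext fun i => Function.extend_apply' _ _ _ fun ⟨k, _⟩ => k.elim0
    simp only [this]
  | succ n ih =>
    rw [avg_succ, integral_resample (e 0) hg hM]
    simp only [extend_cons he]
    have h := fun c => ih (e := fun k => e k.succ) (he.comp (Fin.succ_injective n))
      (hg.comp (measurable_update_const (e 0) (bitValue a b c))) (fun y => hM _)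
    simp only [Function.comp_apply] at h
    rw [h, h, add_comm]
    rfl

/-! ### From the finite cube to countably many bits. -/

/-- Half the oscillation of `F` in the coordinate `i`. -/
noncomputable def oscillation [DecidableEq ι] (a b : ℝ) (F : (ι → ℝ) → ℝ) (i : ι) (y : ι → ℝ) :
    ℝ :=
  |F (Function.update y i b) - F (Function.update y i a)| / 2

theorem oscillation_nonneg [DecidableEq ι] (F : (ι → ℝ) → ℝ) (i : ι) (y : ι → ℝ) :
    0 ≤ oscillation a b F i y :=
  div_nonneg (abs_nonneg _) zero_le_two

theorem continuous_oscillation [DecidableEq ι] {F : (ι → ℝ) → ℝ} (hF : Continuous F) (i : ι) :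
    Continuous (oscillation a b F i) :=
  ((hF.comp (continuous_update_const i b)).sub
    (hF.comp (continuous_update_const i a))).abs.div_const 2

theorem abs_oscillation_le [DecidableEq ι] {F : (ι → ℝ) → ℝ} {M : ℝ} (hM : ∀ y, |F y| ≤ M)
    (i : ι) (y : ι → ℝ) : |oscillation a b F i y| ≤ M := by
  rw [abs_of_nonneg (oscillation_nonneg F i y), oscillation]
  have h1 := abs_sub (F (Function.update y i b)) (F (Function.update y i a))
  linarith [hM (Function.update y i b), hM (Function.update y i a)]

theorem sq_integral_le {Ω : Type*} [MeasurableSpace Ω] {μ : Measure Ω} [IsProbabilityMeasure μ]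
    {g : Ω → ℝ} (hg : Measurable g) {M : ℝ} (hM : ∀ y, |g y| ≤ M) :
    (∫ y, g y ∂μ) ^ 2 ≤ ∫ y, g y ^ 2 ∂μ := by
  have hm : MemLp g 2 μ := MemLp.of_bound hg.aestronglyMeasurable M (Filter.Eventually.of_forall hM)
  have h := variance_eq_sub hm
  have h0 := variance_nonneg g μ
  simp only [Pi.pow_apply] at h
  linarith

theorem abs_sq_le_sq {t M : ℝ} (h : |t| ≤ M) : |t ^ 2| ≤ M ^ 2 := by
  rw [abs_pow]
  exact pow_le_pow_left₀ (abs_nonneg _) h 2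

open BooleanCube in
theorem abs_influence_le [Countable ι] [DecidableEq ι] {F : (ι → ℝ) → ℝ} (hF : Continuous F) {M : ℝ}
    (hM : ∀ y, |F y| ≤ M) {n : ℕ} {e : Fin n → ι} (he : Function.Injective e) (k : Fin n)
    (x : Fin n → Bool) :
    |influence k (fun x => ∫ y, F (Function.extend e (fun k => bitValue a b (x k)) y)
      ∂productLaw ι a b) x|
      ≤ ∫ y, oscillation a b F (e k) (Function.extend e (fun k => bitValue a b (x k)) y)
        ∂productLaw ι a b := by
  have hint : ∀ v : Fin n → ℝ, Integrable (fun y => F (Function.extend e v y))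
      (productLaw ι a b) := fun v =>
    integrable_of_abs_le (hF.comp (continuous_extend_right e v)).measurable fun y => hM _
  rw [influence, ← integral_sub (hint _) (hint _), ← integral_div]
  refine abs_integral_le_integral_abs.trans_eq
    (integral_congr_ae (Filter.Eventually.of_forall ?_))
  intro y
  have hx : (fun j => bitValue a b (Function.update x k (!x k) j))
      = Function.update (fun j => bitValue a b (x j)) k (bitValue a b (!x k)) := by
    ext j
    rcases eq_or_ne j k with rfl | h
    · simp
    · simp [h]
  have hz : Function.extend e (fun j => bitValue a b (x j)) y
      = Function.update (Function.extend e (fun j => bitValue a b (x j)) y) (e k)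
        (bitValue a b (x k)) := by
    rw [eq_comm, Function.update_eq_self_iff, he.extend_apply]
  simp only [hx, extend_update he]
  generalize Function.extend e (fun j => bitValue a b (x j)) y = z at hz ⊢
  rw [oscillation, abs_div, abs_of_pos (two_pos : (0 : ℝ) < 2)]
  congr 1
  rw [show F z = F (Function.update z (e k) (bitValue a b (x k))) by rw [← hz]]
  cases x k
  · exact abs_sub_comm _ _
  · rfl

theorem abs_integral_le_of_abs_le {Ω : Type*} [MeasurableSpace Ω] {μ : Measure Ω}
    [IsProbabilityMeasure μ] {g : Ω → ℝ} {M : ℝ} (hM : ∀ y, |g y| ≤ M) : |∫ y, g y ∂μ| ≤ M := by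
  have := norm_integral_le_of_norm_le_const (μ := μ) (C := M) (f := g)
    (Filter.Eventually.of_forall hM)
  simpa using this

theorem continuous_integral_extend [Countable ι] {F : (ι → ℝ) → ℝ} (hF : Continuous F)
    {M : ℝ} (hM : ∀ y, |F y| ≤ M) {n : ℕ} (e : Fin n → ι) :
    Continuous fun z : ι → ℝ =>
      ∫ y, F (Function.extend e (fun k => z (e k)) y) ∂productLaw ι a b := by
  refine continuous_of_dominated (bound := fun _ => M) (fun z => ?_) (fun z => ?_)
    (integrable_const _) (Filter.Eventually.of_forall fun y => ?_)
  · exact (hF.comp (continuous_extend_right e _)).measurable.aestronglyMeasurable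
  · exact Filter.Eventually.of_forall fun y => hM _
  · exact hF.comp ((continuous_extend_uncurry e).comp
      (by fun_prop : Continuous fun z : ι → ℝ => ((fun k => z (e k)), y)))

/-- The partial averages of a bounded continuous function converge to it in mean square. -/
theorem tendsto_integral_sq_integral_extend [Countable ι] {F : (ι → ℝ) → ℝ} (hF : Continuous F)
    {M : ℝ} (hM : ∀ y, |F y| ≤ M) :
    Filter.Tendsto (fun s : Finset ι => ∫ z, (∫ y, F (Function.extend
        (fun k => (s.equivFin.symm k : ι)) (fun k => z (s.equivFin.symm k)) y)
          ∂productLaw ι a b) ^ 2 ∂productLaw ι a b) Filter.atTop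
      (nhds (∫ z, F z ^ 2 ∂productLaw ι a b)) := by
  refine tendsto_integral_filter_of_dominated_convergence (fun _ => M ^ 2)
    (Filter.Eventually.of_forall fun s => ?_) (Filter.Eventually.of_forall fun s =>
      Filter.Eventually.of_forall fun z => ?_) (integrable_const _)
    (Filter.Eventually.of_forall fun z => ?_)
  · exact ((continuous_integral_extend hF hM _).pow 2).measurable.aestronglyMeasurable
  · exact abs_sq_le_sq (abs_integral_le_of_abs_le fun y => hM _)
  · refine Filter.Tendsto.pow ?_ 2
    have hlim : Filter.Tendsto (fun s : Finset ι => ∫ y, F (Function.extend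
        (fun k => (s.equivFin.symm k : ι)) (fun k => z (s.equivFin.symm k)) y)
          ∂productLaw ι a b) Filter.atTop (nhds (∫ _, F z ∂productLaw ι a b)) := by
      refine tendsto_integral_filter_of_dominated_convergence (fun _ => M)
        (Filter.Eventually.of_forall fun s => ?_) (Filter.Eventually.of_forall fun s =>
          Filter.Eventually.of_forall fun y => hM _) (integrable_const _)
        (Filter.Eventually.of_forall fun y => ?_)
      · exact (hF.comp (continuous_extend_right _ _)).measurable.aestronglyMeasurable
      -- Once `s` contains `i`, coordinate `i` of the extension equals `z i`; continuity of `F` in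
      -- the product topology then gives pointwise convergence, with no martingale theorem.
      · refine (hF.tendsto z).comp (tendsto_pi_nhds.2 fun i => ?_)
        refine tendsto_const_nhds.congr' ?_
        filter_upwards [Filter.eventually_ge_atTop {i}] with s hs
        have hi : i ∈ s := hs (Finset.mem_singleton_self i)
        have hinj : Function.Injective fun k => (s.equivFin.symm k : ι) :=
          Subtype.val_injective.comp s.equivFin.symm.injective
        have := hinj.extend_apply (fun k => z (s.equivFin.symm k)) y (s.equivFin ⟨i, hi⟩)
        simpa using this.symm
    simpa using hlim

open BooleanCube in
/-- The Falik–Samorodnitsky inequality for a bounded continuous function of countably many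
independent bits, in a form that is linear in the variance. -/
theorem integral_sq_sub_mul_one_add_log_le [Countable ι] [DecidableEq ι] {F : (ι → ℝ) → ℝ}
    (hF : Continuous F) {M : ℝ} (hM : ∀ y, |F y| ≤ M) {S D c : ℝ} (hc : 0 < c)
    (hS : ∀ s : Finset ι,
      ∑ i ∈ s, (∫ y, oscillation a b F i y ∂productLaw ι a b) ^ 2 ≤ S)
    (hD : ∀ s : Finset ι,
      ∑ i ∈ s, ∫ y, oscillation a b F i y ^ 2 ∂productLaw ι a b ≤ D) :
    (∫ y, F y ^ 2 ∂productLaw ι a b - (∫ y, F y ∂productLaw ι a b) ^ 2) * (1 + Real.log c)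
      ≤ c * S + 2 * D := by
  -- The cube inequality is applied to the conditional mean of `F` given the coordinates in `s`. Its
  -- influences are dominated by the oscillations of `F`, and `S`, `D` do not depend on `s`.
  refine le_of_tendsto (((tendsto_integral_sq_integral_extend (a := a) (b := b) hF hM).sub_const
    _).mul_const _) (Filter.Eventually.of_forall fun s => ?_)
  set e : Fin s.card → ι := fun k => (s.equivFin.symm k : ι) with hedef
  have he : Function.Injective e := Subtype.val_injective.comp s.equivFin.symm.injective
  have hsum : ∀ w : ι → ℝ, ∑ k, w (e k) = ∑ i ∈ s, w i := by
    intro w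
    rw [← Finset.sum_coe_sort s w]
    exact Fintype.sum_equiv s.equivFin.symm _ _ fun k => rfl
  set f : (Fin s.card → Bool) → ℝ := fun x =>
    ∫ y, F (Function.extend e (fun k => bitValue a b (x k)) y) ∂productLaw ι a b with hf
  have hcube := variance_mul_one_add_log_le f hc
  have hmean : avg f = ∫ y, F y ∂productLaw ι a b := avg_integral_extend he hF.measurable hM
  set g : (ι → ℝ) → ℝ := fun z =>
    ∫ y, F (Function.extend e (fun k => z (e k)) y) ∂productLaw ι a b with hg
  have hgm : Continuous g := continuous_integral_extend hF hM e
  have hgb : ∀ z, |g z| ≤ M := fun z => abs_integral_le_of_abs_le fun y => hM _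
  have hsq : avg (fun x => f x ^ 2) = ∫ z, g z ^ 2 ∂productLaw ι a b := by
    rw [← avg_integral_extend (a := a) (b := b) (g := fun z => g z ^ 2) he (hgm.pow 2).measurable
      fun z => abs_sq_le_sq (hgb z)]
    congr 1
    ext x
    have : ∀ w, g (Function.extend e (fun k => bitValue a b (x k)) w) = f x := by
      intro w
      simp only [hg, hf, he.extend_apply]
    simp [this]
  have hosc : ∀ k, avg (fun x => |influence k f x|)
      ≤ ∫ y, oscillation a b F (e k) y ∂productLaw ι a b := by
    intro k
    rw [← avg_integral_extend he (continuous_oscillation hF (e k)).measurable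
      (abs_oscillation_le hM (e k))]
    exact avg_mono fun x => abs_influence_le hF hM he k x
  have hosc2 : ∀ k, avg (fun x => influence k f x ^ 2)
      ≤ ∫ y, oscillation a b F (e k) y ^ 2 ∂productLaw ι a b := by
    intro k
    rw [← avg_integral_extend (g := fun y => oscillation a b F (e k) y ^ 2) he
      ((continuous_oscillation hF (e k)).pow 2).measurable
      fun y => abs_sq_le_sq (abs_oscillation_le hM (e k) y)]
    refine avg_mono fun x => ?_
    rw [← sq_abs]
    exact (pow_le_pow_left₀ (abs_nonneg _) (abs_influence_le hF hM he k x) 2).trans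
      (sq_integral_le ((continuous_oscillation hF (e k)).comp
        (continuous_extend_right e _)).measurable fun y => abs_oscillation_le hM (e k) _)
  have h1 : ∑ k, avg (fun x => |influence k f x|) ^ 2 ≤ S := by
    refine le_trans (Finset.sum_le_sum fun k _ =>
      pow_le_pow_left₀ (avg_nonneg fun _ => abs_nonneg _) (hosc k) 2) ?_
    rw [hsum fun i => (∫ y, oscillation a b F i y ∂productLaw ι a b) ^ 2]
    exact hS s
  have h2 : ∑ k, avg (fun x => influence k f x ^ 2) ≤ D := by
    refine le_trans (Finset.sum_le_sum fun k _ => hosc2 k) ?_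
    rw [hsum fun i => ∫ y, oscillation a b F i y ^ 2 ∂productLaw ι a b]
    exact hD s
  rw [hsq, hmean] at hcube
  have h3 := mul_le_mul_of_nonneg_left h1 hc.le
  exact hcube.trans (by linarith)

end ProductLaw

end ElectricNetwork

/-! ### Influences of the random effective resistance. -/

namespace ElectricNetwork

variable {V E : Type*}

/-- A locally finite network with disjoint nonempty terminals, joined by a flow of finite energy,
and a range `[a, b]` of positive resistances. -/
structure IsAdmissible (G : Graph V E) (A Z : Finset V) (a b : ℝ) : Prop where
  locallyFinite : LocallyFinite G
  disjoint : Disjoint A Z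
  nonempty_left : A.Nonempty
  nonempty_right : Z.Nonempty
  pos : 0 < a
  le : a ≤ b
  exists_flow : ∃ φ, IsFlow G A Z 1 φ ∧ Summable fun e => φ e ^ 2

/-- The effective resistance after truncation of the resistances to `[a, b]`. -/
noncomputable def clampedResistance (G : Graph V E) (A Z : Finset V) (a b : ℝ)
    (y : G.edgeSet → ℝ) : ℝ :=
  effectiveResistance G A Z fun e => clamp a b (y e)

/-- The minimal flow after truncation of the resistances to `[a, b]`. -/
noncomputable def clampedFlow (G : Graph V E) (A Z : Finset V) (a b : ℝ)
    (y : G.edgeSet → ℝ) : G.edgeSet → ℝ :=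
  minimalFlow G A Z fun e => clamp a b (y e)

/-- The energy dissipated in an edge after truncation of the resistances to `[a, b]`. -/
noncomputable def clampedEnergy (G : Graph V E) (A Z : Finset V) (a b : ℝ) (e : G.edgeSet)
    (y : G.edgeSet → ℝ) : ℝ :=
  clamp a b (y e) * clampedFlow G A Z a b y e ^ 2

section Clamped

variable {G : Graph V E} {A Z : Finset V} {a b : ℝ}

/-- Truncation makes every point of the product space a legitimate choice of resistances, so
continuity and bounds hold everywhere; the law lives on `{a, b}`, where truncation does nothing. -/
theorem IsAdmissible.isPythagoreanFlow (h : IsAdmissible G A Z a b) (y : G.edgeSet → ℝ) :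
    IsPythagoreanFlow G A Z (fun e => clamp a b (y e)) (clampedFlow G A Z a b y) := by
  obtain ⟨φ, hφ, hφs⟩ := h.exists_flow
  exact isPythagoreanFlow_minimalFlow h.locallyFinite h.disjoint h.nonempty_left
    h.nonempty_right h.pos (fun e => clamp_mem h.le (y e)) hφ hφs

theorem IsAdmissible.clamp_pos (h : IsAdmissible G A Z a b) (t : ℝ) : 0 < clamp a b t :=
  h.pos.trans_le (clamp_mem h.le t).1

theorem IsAdmissible.tendsto (h : IsAdmissible G A Z a b) (y : G.edgeSet → ℝ) :
    (∀ e, Filter.Tendsto (fun z => clampedFlow G A Z a b z e) (nhds y)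
      (nhds (clampedFlow G A Z a b y e))) ∧
    Filter.Tendsto (clampedResistance G A Z a b) (nhds y)
      (nhds (clampedResistance G A Z a b y)) := by
  obtain ⟨φ, hφ, hφs⟩ := h.exists_flow
  refine tendsto_minimalFlow h.locallyFinite h.disjoint h.nonempty_left h.nonempty_right h.pos
    hφ hφs (fun e => clamp_mem h.le (y e)) (fun z e => clamp_mem h.le (z e)) ?_
  refine tendsto_pi_nhds.2 fun e => ?_
  exact ((continuous_clamp a b).comp (continuous_apply e)).tendsto y

theorem IsAdmissible.continuous_clampedResistance (h : IsAdmissible G A Z a b) :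
    Continuous (clampedResistance G A Z a b) :=
  continuous_iff_continuousAt.2 fun y => (h.tendsto y).2

theorem IsAdmissible.continuous_clampedFlow (h : IsAdmissible G A Z a b) (e : G.edgeSet) :
    Continuous fun y => clampedFlow G A Z a b y e :=
  continuous_iff_continuousAt.2 fun y => (h.tendsto y).1 e

theorem IsAdmissible.continuous_clampedEnergy (h : IsAdmissible G A Z a b) (e : G.edgeSet) :
    Continuous (clampedEnergy G A Z a b e) :=
  ((continuous_clamp a b).comp (continuous_apply e)).mul ((h.continuous_clampedFlow e).pow 2)

theorem IsAdmissible.clampedFlow_sq_le_one (h : IsAdmissible G A Z a b) (y : G.edgeSet → ℝ)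
    (e : G.edgeSet) : clampedFlow G A Z a b y e ^ 2 ≤ 1 := by
  rw [← sq_abs]
  exact pow_le_one₀ (abs_nonneg _) ((h.isPythagoreanFlow y).abs_le_one e)

theorem IsAdmissible.clampedEnergy_nonneg (h : IsAdmissible G A Z a b) (e : G.edgeSet)
    (y : G.edgeSet → ℝ) : 0 ≤ clampedEnergy G A Z a b e y :=
  mul_nonneg (h.clamp_pos _).le (sq_nonneg _)

theorem IsAdmissible.abs_clampedEnergy_le (h : IsAdmissible G A Z a b) (e : G.edgeSet)
    (y : G.edgeSet → ℝ) : |clampedEnergy G A Z a b e y| ≤ b := by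
  rw [abs_of_nonneg (h.clampedEnergy_nonneg e y)]
  exact (mul_le_of_le_one_right (h.clamp_pos _).le (h.clampedFlow_sq_le_one y e)).trans
    (clamp_mem h.le _).2

theorem IsAdmissible.clampedResistance_pos (h : IsAdmissible G A Z a b) (y : G.edgeSet → ℝ) :
    0 < clampedResistance G A Z a b y :=
  (h.isPythagoreanFlow y).effectiveResistance_pos fun _ => h.clamp_pos _

theorem IsAdmissible.exists_abs_clampedResistance_le (h : IsAdmissible G A Z a b) :
    ∃ M, ∀ y, |clampedResistance G A Z a b y| ≤ M := by
  obtain ⟨φ, hφ, hφs⟩ := h.exists_flow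
  refine ⟨∑' e, b * φ e ^ 2, fun y => ?_⟩
  rw [abs_of_pos (h.clampedResistance_pos y), clampedResistance,
    (h.isPythagoreanFlow y).effectiveResistance_eq fun _ => h.clamp_pos _]
  have hs := summable_mul_sq h.pos (fun e => clamp_mem h.le (y e)) hφs
  refine ((h.isPythagoreanFlow y).tsum_le (fun _ => h.clamp_pos _) hφ hs).trans ?_
  exact hs.tsum_le_tsum
    (fun e => mul_le_mul_of_nonneg_right (clamp_mem h.le (y e)).2 (sq_nonneg _)) (hφs.mul_left b)

theorem IsAdmissible.sum_clampedEnergy_le (h : IsAdmissible G A Z a b) (s : Finset G.edgeSet)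
    (y : G.edgeSet → ℝ) :
    ∑ e ∈ s, clampedEnergy G A Z a b e y ≤ clampedResistance G A Z a b y := by
  rw [clampedResistance,
    (h.isPythagoreanFlow y).effectiveResistance_eq fun _ => h.clamp_pos _]
  exact (h.isPythagoreanFlow y).summable.sum_le_tsum s fun e _ => h.clampedEnergy_nonneg e y

theorem clamp_update [DecidableEq G.edgeSet] (y : G.edgeSet → ℝ) (e : G.edgeSet) {t : ℝ}
    (ht : t ∈ Set.Icc a b) :
    (fun e' => clamp a b (Function.update y e t e'))
      = Function.update (fun e' => clamp a b (y e')) e t := by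
  ext e'
  rcases eq_or_ne e' e with rfl | he
  · simp [clamp_of_mem ht.1 ht.2]
  · simp [he]

/-- The competitor bound from `a` to `b` gives the estimate; the one from `b` to `a` shows that
raising the resistance does not lower `f`, which removes the absolute value. -/
theorem IsAdmissible.oscillation_le [DecidableEq G.edgeSet] (h : IsAdmissible G A Z a b)
    (e : G.edgeSet) (y : G.edgeSet → ℝ) :
    oscillation a b (clampedResistance G A Z a b) e y
      ≤ (b - a) / 2 * clampedFlow G A Z a b (Function.update y e a) e ^ 2 := by
  obtain ⟨φ, hφ, hφs⟩ := h.exists_flow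
  have hamem : a ∈ Set.Icc a b := ⟨le_rfl, h.le⟩
  have hbmem : b ∈ Set.Icc a b := ⟨h.le, le_rfl⟩
  have key : ∀ {s t : ℝ}, s ∈ Set.Icc a b → t ∈ Set.Icc a b →
      clampedResistance G A Z a b (Function.update y e t)
        ≤ clampedResistance G A Z a b (Function.update y e s)
          + (t - s) * clampedFlow G A Z a b (Function.update y e s) e ^ 2 := by
    intro s t hs ht
    have := effectiveResistance_update_le h.locallyFinite h.disjoint h.nonempty_left
      h.nonempty_right h.pos hφ hφs
      (r := fun e' => clamp a b (Function.update y e s e')) (fun e' => clamp_mem h.le _) e ht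
    rw [← clamp_update _ _ ht, Function.update_idem] at this
    simpa [clampedResistance, clampedFlow, clamp_of_mem hs.1 hs.2] using this
  have h1 := key hamem hbmem
  have h2 := key hbmem hamem
  have h3 : 0 ≤ (b - a) * clampedFlow G A Z a b (Function.update y e b) e ^ 2 :=
    mul_nonneg (sub_nonneg.2 h.le) (sq_nonneg _)
  rw [oscillation, abs_of_nonneg (by linarith)]
  linarith

/-- The mean energy dissipated in an edge. -/
noncomputable def meanEnergy (G : Graph V E) (A Z : Finset V) (a b : ℝ) (e : G.edgeSet) : ℝ :=
  ∫ y, clampedEnergy G A Z a b e y ∂productLaw G.edgeSet a b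

theorem IsAdmissible.meanEnergy_nonneg (h : IsAdmissible G A Z a b) (e : G.edgeSet) :
    0 ≤ meanEnergy G A Z a b e :=
  integral_nonneg (h.clampedEnergy_nonneg e)

theorem IsAdmissible.abs_oscillation_le [DecidableEq G.edgeSet] (h : IsAdmissible G A Z a b)
    (e : G.edgeSet) (y : G.edgeSet → ℝ) :
    |oscillation a b (clampedResistance G A Z a b) e y| ≤ (b - a) / 2 := by
  rw [abs_of_nonneg (oscillation_nonneg _ _ _)]
  refine (h.oscillation_le e y).trans (mul_le_of_le_one_right ?_ (h.clampedFlow_sq_le_one _ e))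
  linarith [h.le]

theorem IsAdmissible.integral_oscillation_le_const [DecidableEq G.edgeSet]
    (h : IsAdmissible G A Z a b) (e : G.edgeSet) :
    ∫ y, oscillation a b (clampedResistance G A Z a b) e y ∂productLaw G.edgeSet a b
      ≤ (b - a) / 2 :=
  (le_abs_self _).trans (abs_integral_le_of_abs_le (h.abs_oscillation_le e))

variable [Countable G.edgeSet]

theorem IsAdmissible.integrable_clampedEnergy (h : IsAdmissible G A Z a b) (e : G.edgeSet) :
    Integrable (clampedEnergy G A Z a b e) (productLaw G.edgeSet a b) :=
  integrable_of_abs_le (h.continuous_clampedEnergy e).measurable (h.abs_clampedEnergy_le e)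

theorem IsAdmissible.integrable_clampedResistance (h : IsAdmissible G A Z a b) :
    Integrable (clampedResistance G A Z a b) (productLaw G.edgeSet a b) := by
  obtain ⟨M, hM⟩ := h.exists_abs_clampedResistance_le
  exact integrable_of_abs_le h.continuous_clampedResistance.measurable hM

theorem IsAdmissible.sum_meanEnergy_le (h : IsAdmissible G A Z a b) (s : Finset G.edgeSet) :
    ∑ e ∈ s, meanEnergy G A Z a b e
      ≤ ∫ y, clampedResistance G A Z a b y ∂productLaw G.edgeSet a b := by
  unfold meanEnergy
  rw [← integral_finsetSum _ fun e _ => h.integrable_clampedEnergy e]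
  exact integral_mono (integrable_finsetSum _ fun e _ => h.integrable_clampedEnergy e)
    h.integrable_clampedResistance fun y => h.sum_clampedEnergy_le s y

theorem IsAdmissible.integral_clampedResistance_pos (h : IsAdmissible G A Z a b) :
    0 < ∫ y, clampedResistance G A Z a b y ∂productLaw G.edgeSet a b := by
  rw [integral_pos_iff_support_of_nonneg (fun y => (h.clampedResistance_pos y).le)
    h.integrable_clampedResistance]
  have : Function.support (clampedResistance G A Z a b) = Set.univ :=
    Set.eq_univ_of_forall fun y => (h.clampedResistance_pos y).ne'
  simp [this]

variable [DecidableEq G.edgeSet]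

/-- Resampling `e`, half of its mean energy comes from `r_e = a`, where it is `a θ(e)²`; the other
half is nonnegative and dropped. -/
theorem IsAdmissible.integral_clampedFlow_sq_le (h : IsAdmissible G A Z a b) (e : G.edgeSet) :
    ∫ y, clampedFlow G A Z a b (Function.update y e a) e ^ 2 ∂productLaw G.edgeSet a b
      ≤ 2 / a * meanEnergy G A Z a b e := by
  rw [meanEnergy, integral_resample e (h.continuous_clampedEnergy e).measurable
    (h.abs_clampedEnergy_le e)]
  have h1 : ∀ y, clampedEnergy G A Z a b e (Function.update y e a)
      = a * clampedFlow G A Z a b (Function.update y e a) e ^ 2 := by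
    intro y
    rw [clampedEnergy, Function.update_self, clamp_of_mem le_rfl h.le]
  simp only [h1]
  rw [integral_const_mul]
  have h2 : 0 ≤ ∫ y, clampedEnergy G A Z a b e (Function.update y e b)
      ∂productLaw G.edgeSet a b := integral_nonneg fun y => h.clampedEnergy_nonneg e _
  have ha := h.pos
  have e1 : ∀ I J : ℝ, 2 / a * ((a * I + J) / 2) = I + J / a := by
    intro I J
    field_simp
  rw [e1]
  exact le_add_of_nonneg_right (div_nonneg h2 ha.le)

theorem IsAdmissible.integrable_clampedFlow_update_sq (h : IsAdmissible G A Z a b)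
    (e : G.edgeSet) :
    Integrable (fun y => clampedFlow G A Z a b (Function.update y e a) e ^ 2)
      (productLaw G.edgeSet a b) :=
  integrable_of_abs_le (M := 1)
    (((h.continuous_clampedFlow e).comp (continuous_update_const e a)).pow 2).measurable
    fun _ => (abs_of_nonneg (sq_nonneg _)).trans_le (h.clampedFlow_sq_le_one _ e)

theorem IsAdmissible.integral_oscillation_le (h : IsAdmissible G A Z a b) (e : G.edgeSet) :
    ∫ y, oscillation a b (clampedResistance G A Z a b) e y ∂productLaw G.edgeSet a b
      ≤ (b - a) / a * meanEnergy G A Z a b e := by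
  have hba : 0 ≤ (b - a) / 2 := by linarith [h.le]
  calc _ ≤ ∫ y, (b - a) / 2 * clampedFlow G A Z a b (Function.update y e a) e ^ 2
        ∂productLaw G.edgeSet a b :=
      integral_mono (integrable_of_abs_le
        (continuous_oscillation h.continuous_clampedResistance e).measurable
        (h.abs_oscillation_le e)) ((h.integrable_clampedFlow_update_sq e).const_mul _)
        (h.oscillation_le e)
    _ ≤ (b - a) / 2 * (2 / a * meanEnergy G A Z a b e) := by
      rw [integral_const_mul]
      exact mul_le_mul_of_nonneg_left (h.integral_clampedFlow_sq_le e) hba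
    _ = _ := by
      have := h.pos
      field_simp

theorem IsAdmissible.integral_oscillation_sq_le (h : IsAdmissible G A Z a b) (e : G.edgeSet) :
    ∫ y, oscillation a b (clampedResistance G A Z a b) e y ^ 2 ∂productLaw G.edgeSet a b
      ≤ (b - a) ^ 2 / (2 * a) * meanEnergy G A Z a b e := by
  calc
    _ ≤ ∫ y, ((b - a) / 2) ^ 2 * clampedFlow G A Z a b (Function.update y e a) e ^ 2
        ∂productLaw G.edgeSet a b := by
      have hi : Integrable (fun y => oscillation a b (clampedResistance G A Z a b) e y ^ 2)
          (productLaw G.edgeSet a b) := integrable_of_abs_le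
        ((continuous_oscillation h.continuous_clampedResistance e).pow 2).measurable
        fun y => abs_sq_le_sq (h.abs_oscillation_le e y)
      refine integral_mono hi ((h.integrable_clampedFlow_update_sq e).const_mul _) fun y => ?_
      have hle := pow_le_pow_left₀ (oscillation_nonneg _ _ _) (h.oscillation_le e y) 2
      refine hle.trans ?_
      rw [mul_pow]
      refine mul_le_mul_of_nonneg_left ?_ (sq_nonneg _)
      -- The current bound turns `θ(e)⁴` into `θ(e)²`, which is again controlled by the mean energy.
      exact pow_le_of_le_one (sq_nonneg _) (h.clampedFlow_sq_le_one _ e) two_ne_zero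
    _ ≤ ((b - a) / 2) ^ 2 * (2 / a * meanEnergy G A Z a b e) := by
      rw [integral_const_mul]
      exact mul_le_mul_of_nonneg_left (h.integral_clampedFlow_sq_le e) (sq_nonneg _)
    _ = _ := by
      have := h.pos
      field_simp

theorem IsAdmissible.sum_integral_oscillation_sq_le (h : IsAdmissible G A Z a b) {K : ℝ}
    (hK : (b - a) ^ 2 / (2 * a) ≤ K) (s : Finset G.edgeSet) :
    ∑ e ∈ s, ∫ y, oscillation a b (clampedResistance G A Z a b) e y ^ 2
        ∂productLaw G.edgeSet a b
      ≤ K * ∫ y, clampedResistance G A Z a b y ∂productLaw G.edgeSet a b := by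
  have hK0 : 0 ≤ K := le_trans (div_nonneg (sq_nonneg _) (by linarith [h.pos])) hK
  refine le_trans (Finset.sum_le_sum fun e _ => (h.integral_oscillation_sq_le e).trans
    (mul_le_mul_of_nonneg_right hK (h.meanEnergy_nonneg e))) ?_
  rw [← Finset.mul_sum]
  exact mul_le_mul_of_nonneg_left (h.sum_meanEnergy_le s) hK0

/-- On `Em` one factor of the squared mean energy is bounded by `α` and the other summed; each of
the finitely many remaining edges costs at most `(b - a)²`. -/
theorem IsAdmissible.sum_sq_integral_oscillation_le (h : IsAdmissible G A Z a b)
    {Em : Set G.edgeSet} (hEm : Emᶜ.Finite) {α : ℝ} (hα0 : 0 ≤ α)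
    (hα : ∀ e ∈ Em, meanEnergy G A Z a b e ≤ α) (s : Finset G.edgeSet) :
    ∑ e ∈ s, (∫ y, oscillation a b (clampedResistance G A Z a b) e y
        ∂productLaw G.edgeSet a b) ^ 2
      ≤ ((b - a) / a) ^ 2 * α * (∫ y, clampedResistance G A Z a b y ∂productLaw G.edgeSet a b)
        + (b - a) ^ 2 * Emᶜ.ncard := by
  classical
  have hnn : ∀ e, 0 ≤ ∫ y, oscillation a b (clampedResistance G A Z a b) e y
      ∂productLaw G.edgeSet a b := fun e =>
    integral_nonneg fun y => oscillation_nonneg _ _ _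
  rw [← Finset.sum_filter_add_sum_filter_not s (· ∈ Em)]
  refine add_le_add ?_ ?_
  · refine le_trans (Finset.sum_le_sum (g := fun e =>
      ((b - a) / a) ^ 2 * α * meanEnergy G A Z a b e) fun e he => ?_) ?_
    · refine (pow_le_pow_left₀ (hnn e) (h.integral_oscillation_le e) 2).trans ?_
      rw [mul_pow, mul_assoc, sq (meanEnergy G A Z a b e)]
      exact mul_le_mul_of_nonneg_left (mul_le_mul_of_nonneg_right
        (hα e (Finset.mem_filter.1 he).2) (h.meanEnergy_nonneg e)) (sq_nonneg _)
    · rw [← Finset.mul_sum]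
      exact mul_le_mul_of_nonneg_left (h.sum_meanEnergy_le _) (mul_nonneg (sq_nonneg _) hα0)
  · refine (Finset.sum_le_card_nsmul _ _ ((b - a) ^ 2) fun e _ => ?_).trans ?_
    · refine pow_le_pow_left₀ (hnn e) ((h.integral_oscillation_le_const e).trans ?_) 2
      linarith [h.le]
    · rw [nsmul_eq_mul, mul_comm, Set.ncard_eq_toFinset_card _ hEm]
      refine mul_le_mul_of_nonneg_left (Nat.cast_le.2 (Finset.card_le_card fun e he => ?_))
        (sq_nonneg _)
      simpa using (Finset.mem_filter.1 he).2

end Clamped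

/-! ### Optimisation in `c` and conclusion. -/

theorem le_div_log_of_forall_mul_log_le {v m K ε : ℝ} (hm : 0 < m) (hK : Real.exp 1 ≤ K)
    (hε0 : 0 ≤ ε) (hε1 : ε < 1) (hv : 0 ≤ v)
    (H : ∀ c, 0 < c → v * (1 + Real.log c) ≤ c * (ε * m) + 2 * (K * m)) :
    v ≤ 2 * K * m / Real.log (K / (ε * Real.log (K / ε))) := by
  have hK0 : 0 < K := (Real.exp_pos 1).trans_le hK
  rcases hε0.eq_or_lt with rfl | hε
  -- With `ε = 0` the right-hand side evaluates to `0`. If `v > 0`, the choice `c = exp (2Km / v)`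
  -- would give `v + 2Km ≤ 2Km`.
  · simp only [zero_mul, div_zero, Real.log_zero]
    by_contra hlt
    push Not at hlt
    have h1 := H (Real.exp (2 * (K * m) / v)) (Real.exp_pos _)
    rw [Real.log_exp, mul_add, mul_div_cancel₀ _ hlt.ne'] at h1
    linarith
  set X := Real.log (K / ε) with hX
  -- This is the use of `K ≥ e` and `ε < 1`: it gives `X ≥ 1`, so the denominator `X - log X` is
  -- positive.
  have hKε : Real.exp 1 ≤ K / ε := by
    rw [le_div_iff₀ hε]
    nlinarith [Real.exp_pos 1]
  have hX1 : 1 ≤ X := by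
    rw [hX, Real.le_log_iff_exp_le (by positivity)]
    exact hKε
  have hX0 : 0 < X := by linarith
  have hL : Real.log (K / (ε * X)) = X - Real.log X := by
    rw [← div_div, Real.log_div (by positivity) hX0.ne']
  have hlog1 := Real.log_le_sub_one_of_pos hX0
  have hlog0 := Real.log_nonneg hX1
  rw [hL, le_div_iff₀ (by linarith)]
  -- If `v ≥ mK / X`, then `c = v / (εm)` is at least `K / (εX)`, and its term `c * (εm) = v`
  -- cancels the `1` in `1 + log c`. Otherwise `vX ≤ mK` already suffices.
  rcases le_total (m * K / X) v with hcase | hcase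
  · have hv0 : 0 < v := lt_of_lt_of_le (by positivity) hcase
    have h1 := H (v / (ε * m)) (by positivity)
    rw [div_mul_cancel₀ _ (by positivity)] at h1
    have h2 : X - Real.log X ≤ Real.log (v / (ε * m)) := by
      rw [← hL]
      refine Real.log_le_log (by positivity) ?_
      rw [div_le_div_iff₀ (by positivity) (by positivity)]
      rw [div_le_iff₀ hX0] at hcase
      nlinarith
    have h3 := mul_le_mul_of_nonneg_left h2 hv
    linarith
  · rw [le_div_iff₀ hX0] at hcase
    have : v * (X - Real.log X) ≤ v * X := mul_le_mul_of_nonneg_left (by linarith) hv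
    nlinarith [mul_pos hm hK0]

end ElectricNetwork

open ElectricNetwork in
theorem proposition2 {V E : Type*} (G : Graph V E)
    (hV : G.vertexSet.Countable) (hG : ElectricNetwork.LocallyFinite G)
    (A Z : Finset V) (hAV : (A : Set V) ⊆ G.vertexSet) (hZV : (Z : Set V) ⊆ G.vertexSet)
    (hA : A.Nonempty) (hZ : Z.Nonempty) (hAZ : Disjoint A Z)
    -- there is a unit flow of finite energy from `A` to `Z`, i.e. the resistance is finite
    (hfin : ∃ θ, ElectricNetwork.IsFlow G A Z 1 θ ∧
      ElectricNetwork.energy G (fun _ => 1) θ ≠ ⊤)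
    (a b : ℝ) (ha : 0 < a) (hab : a ≤ b)
    {Ω : Type*} [MeasurableSpace Ω] (P : Measure Ω) [IsProbabilityMeasure P]
    (r : G.edgeSet → Ω → ℝ) (hr : ∀ e, Measurable (r e)) (hindep : iIndepFun r P)
    (hlaw : ∀ e, P.map (r e) = ElectricNetwork.bernoulliLaw a b)
    (Em : Set G.edgeSet) (hEm : Emᶜ.Finite)
    (f : Ω → ℝ) (hf : f = fun ω => ElectricNetwork.effectiveResistance G A Z (fun e => r e ω))
    (θ : Ω → G.edgeSet → ℝ)
    (hθ : θ = fun ω => ElectricNetwork.minimalFlow G A Z (fun e => r e ω))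
    (α β ε K : ℝ)
    (hα : α = ⨆ e : Em, ∫ ω, r e ω * θ ω e ^ 2 ∂P)
    (hβ : β = (Emᶜ.ncard : ℝ) / ∫ ω, f ω ∂P)
    (hε : ε = ((b - a) / a) ^ 2 * α + (b - a) ^ 2 * β)
    (hK : K = max ((b - a) ^ 2 / (2 * a)) (Real.exp 1))
    (hε1 : ε < 1) :
    -- the quantities above are well defined ...
    (∀ᵐ ω ∂P, ElectricNetwork.IsMinimalFlow G A Z (fun e => r e ω) (θ ω)) ∧
    (∀ e, Integrable (fun ω => r e ω * θ ω e ^ 2) P) ∧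
    MemLp f 2 P ∧ 0 < ∫ ω, f ω ∂P ∧
    -- ... and the variance bound holds; for `a = b` one has `ε = 0` and both sides are `0`
    variance f P ≤ 2 * K * (∫ ω, f ω ∂P) / Real.log (K / (ε * Real.log (K / ε))) := by
  classical
  have : Countable G.edgeSet := countable_edgeSet hV hG
  have h : IsAdmissible G A Z a b := by
    obtain ⟨φ, hφ, hφe⟩ := hfin
    refine ⟨hG, hAZ, hA, hZ, ha, hab, φ, hφ, ?_⟩
    simpa using summable_of_energy_ne_top (fun _ => one_pos) hφe
  set X : Ω → G.edgeSet → ℝ := fun ω e => r e ω with hXdef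
  have hX : Measurable X := measurable_pi_lambda _ hr
  have hXlaw : P.map X = productLaw G.edgeSet a b := by
    rw [hindep.map_fun_eq_infinitePi_map hr, productLaw]
    simp only [hlaw]
  have hclamp : ∀ᵐ ω ∂P, (fun e => clamp a b (X ω e)) = X ω := by
    have h1 := ae_productLaw_mem (ι := G.edgeSet) (a := a) (b := b)
    rw [← hXlaw] at h1
    filter_upwards [ae_of_ae_map hX.aemeasurable h1] with ω hω
    ext e
    rcases hω e with h2 | h2
    · rw [h2, clamp_of_mem le_rfl hab]
    · rw [h2, clamp_of_mem hab le_rfl]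
  have hfae : f =ᵐ[P] fun ω => clampedResistance G A Z a b (X ω) := by
    filter_upwards [hclamp] with ω hω
    rw [hf, clampedResistance, hω]
  have hEae : ∀ e, (fun ω => r e ω * θ ω e ^ 2) =ᵐ[P]
      fun ω => clampedEnergy G A Z a b e (X ω) := by
    intro e
    filter_upwards [hclamp] with ω hω
    rw [hθ, clampedEnergy, clampedFlow, hω, congrFun hω e]
  have hint : ∀ {g : (G.edgeSet → ℝ) → ℝ}, Continuous g →
      ∫ ω, g (X ω) ∂P = ∫ y, g y ∂productLaw G.edgeSet a b := by
    intro g hg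
    rw [← hXlaw, integral_map hX.aemeasurable hg.measurable.aestronglyMeasurable]
  have hEint : ∀ e, ∫ ω, r e ω * θ ω e ^ 2 ∂P = meanEnergy G A Z a b e := fun e => by
    rw [integral_congr_ae (hEae e), hint (h.continuous_clampedEnergy e), meanEnergy]
  have hfint : ∫ ω, f ω ∂P = ∫ y, clampedResistance G A Z a b y ∂productLaw G.edgeSet a b := by
    rw [integral_congr_ae hfae, hint h.continuous_clampedResistance]
  obtain ⟨M, hM⟩ := h.exists_abs_clampedResistance_le
  have hmem : MemLp f 2 P := by
    refine (memLp_congr_ae hfae).2 (MemLp.of_bound ?_ M (Filter.Eventually.of_forall fun ω => hM _))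
    exact (h.continuous_clampedResistance.measurable.comp hX).aestronglyMeasurable
  have hpos := h.integral_clampedResistance_pos
  have hvar : variance f P = ∫ y, clampedResistance G A Z a b y ^ 2 ∂productLaw G.edgeSet a b
      - (∫ y, clampedResistance G A Z a b y ∂productLaw G.edgeSet a b) ^ 2 := by
    rw [variance_eq_sub hmem, hfint, ← hint (g := fun y => clampedResistance G A Z a b y ^ 2)
      (h.continuous_clampedResistance.pow 2)]
    congr 1
    refine integral_congr_ae ?_
    filter_upwards [hfae] with ω hω
    simp [hω]
  have hα' : α = ⨆ e : Em, meanEnergy G A Z a b e := by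
    rw [hα]
    exact congrArg iSup (funext fun e => hEint e)
  have hbdd : BddAbove (Set.range fun e : Em => meanEnergy G A Z a b e) := by
    refine ⟨∫ y, clampedResistance G A Z a b y ∂productLaw G.edgeSet a b, ?_⟩
    rintro _ ⟨e, rfl⟩
    simpa using h.sum_meanEnergy_le {(e : G.edgeSet)}
  have hα0 : 0 ≤ α := by
    rw [hα']
    exact Real.iSup_nonneg fun e => h.meanEnergy_nonneg e
  have hαle : ∀ e ∈ Em, meanEnergy G A Z a b e ≤ α := fun e he => by
    rw [hα']
    exact le_ciSup hbdd ⟨e, he⟩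
  refine ⟨?_, fun e => ?_, hmem, hfint ▸ hpos, ?_⟩
  · filter_upwards [hclamp] with ω hω
    have h1 := (h.isPythagoreanFlow (X ω)).isMinimalFlow fun e => h.clamp_pos _
    rw [clampedFlow, hω] at h1
    rw [hθ]
    exact h1
  · refine (integrable_congr (hEae e)).2 ?_
    have h1 := h.integrable_clampedEnergy e
    rw [← hXlaw] at h1
    exact h1.comp_measurable hX
  · rw [hfint] at hβ ⊢
    set m := ∫ y, clampedResistance G A Z a b y ∂productLaw G.edgeSet a b with hm
    have hβ0 : 0 ≤ β := by
      rw [hβ]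
      positivity
    have hε0 : 0 ≤ ε := by
      rw [hε]
      positivity
    -- Dividing by the mean in `β` makes the bound on the squared `L¹` influences exactly `ε * m`.
    have hεm : ((b - a) / a) ^ 2 * α * m + (b - a) ^ 2 * Emᶜ.ncard = ε * m := by
      rw [hε, hβ]
      field_simp
    refine le_div_log_of_forall_mul_log_le hpos (hK ▸ le_max_right _ _) hε0 hε1
      (variance_nonneg f P) fun c hc => ?_
    rw [hvar]
    exact integral_sq_sub_mul_one_add_log_le h.continuous_clampedResistance hM hc
      (fun s => hεm ▸ h.sum_sq_integral_oscillation_le hEm hα0 hαle s)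
      (h.sum_integral_oscillation_sq_le (hK ▸ le_max_left _ _))
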